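/- All manifolds and maps are smooth. For a compact manifold $V$ with (possibly empty) boundary and a diffeomorphism $\varphi\colon V\to V$ that is the identity on a neighbourhood of $\partial V$, an open book decomposition $\mathrm{OB}(V,\varphi)$ of a closed manifold $N$, with page $V$, binding $\partial V$ and monodromy $\varphi$, is an identification of $N$ with $\mathcal{MT}(V,\varphi)\cup_{\mathrm{id}}(\partial V\times D^2)$, where $\mathcal{MT}(V,\varphi)=V\times\mathbb{R}/\big((x,t+1)\sim(\varphi(x),t)\big)$ is the mapping torus and its boundary $\partial V\times S^1$ is glued to $\partial V\times\partial D^2$ by the identity. A proper embedding $g\colon(V,\partial V)\to(P,\partial P)$ is an embedding with $g^{-1}(\partial P)=\partial V$ that is transverse to $\partial P$. One says that $\mathrm{OB}(V,\varphi)$ spun embeds in $\mathrm{OB}(P,\rho)$ if there is a proper embedding $g\colon(V,\partial V)\to(P,\partial P)$ such that $g\circ\varphi$ and $\rho\circ g$ are isotopic relative to the boundary, i.e. through proper embeddings that agree on $\partial V$. **Theorem.** Let $M$ be a closed orientable $n$-manifold with an open book decomposition $\mathrm{OB}(P^{n-1},\rho)$. Let $B^{n-2}$ be a connected component of the binding $\partial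 P$, and let $\mathrm{OB}(V_B^{n-3},\phi_B)$ be an open book decomposition of $B$. Then for every $k\in\mathbb{Z}$ the open book $\mathrm{OB}(V_B,\phi_B^k)$ spun embeds in $\mathrm{OB}(P,\rho)$, where $\phi_B^k$ is the $k$-fold composition of $\phi_B$. -/

import Mathlib

open Set Module
open scoped Manifold ContDiff Topology

namespace SpunEmbedding

section Models

variable {E : Type*} [NormedAddCommGroup E] [NormedSpace ℝ E] {H : Type*} [TopologicalSpace H]

/-- The model with corners `I` is that of manifolds with (possibly empty) boundary and without
corners: its range is `{x | 0 ≤ ℓ x}` for a continuous linear functional `ℓ`. This is a closed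
half-space if `ℓ ≠ 0` (as for `𝓡∂ d`), and the whole space if `ℓ = 0` (as for `𝓡 d`; this is the
only possibility in dimension `0`). -/
class IsHalfSpaceModel (I : ModelWithCorners ℝ E H) : Prop where
  exists_range_eq : ∃ ℓ : E →L[ℝ] ℝ, range I = {x | 0 ≤ ℓ x}

/-- Orientability of a smooth manifold: some family of smooth charts covers `M` and all
transition maps inside the family have positive Jacobian determinant. -/
def IsOrientable (I : ModelWithCorners ℝ E H) (M : Type*) [TopologicalSpace M]
    [ChartedSpace H M] : Prop :=
  ∃ A : Set (OpenPartialHomeomorph M H), A ⊆ IsManifold.maximalAtlas I ∞ M ∧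
    (∀ x : M, ∃ e ∈ A, x ∈ e.source) ∧
    ∀ e ∈ A, ∀ e' ∈ A, ∀ x ∈ e.source ∩ e'.source,
      0 < (fderivWithin ℝ (e'.extend I ∘ (e.extend I).symm) (range I) (e.extend I x)).det

end Models

section Embeddings

variable {E : Type*} [NormedAddCommGroup E] [NormedSpace ℝ E] {H : Type*} [TopologicalSpace H]
  {E' : Type*} [NormedAddCommGroup E'] [NormedSpace ℝ E'] {H' : Type*} [TopologicalSpace H']
  (I : ModelWithCorners ℝ E H) (J : ModelWithCorners ℝ E' H')
  {V : Type*} [TopologicalSpace V] [ChartedSpace H V]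
  {P : Type*} [TopologicalSpace P] [ChartedSpace H' P]

/-- Smooth embeddings of finite-dimensional manifolds with boundary: smooth maps that are
topological embeddings and have injective differential at every point. -/
structure IsDiffEmbedding (f : V → P) : Prop where
  contMDiff : ContMDiff I J ∞ f
  isEmbedding : Topology.IsEmbedding f
  mfderiv_injective : ∀ x, Function.Injective (mfderiv I J f x)

/-- Proper (neat) embeddings `(V, ∂V) → (P, ∂P)`: smooth embeddings `g` with `g⁻¹(∂P) = ∂V` that
are transverse to `∂P`. The tangent space of `P` at `y` is `E'`, through the preferred chart at
`y`; if that chart takes values in the half-space `{0 ≤ ℓ}` and `y ∈ ∂P`, then the tangent space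
of `∂P` at `y` is the kernel of `ℓ`. -/
structure IsProperEmbedding (g : V → P) : Prop extends IsDiffEmbedding I J g where
  preimage_boundary : g ⁻¹' J.boundary P = I.boundary V
  transverse : ∀ ℓ : E' →L[ℝ] ℝ, range J = {y | 0 ≤ ℓ y} →
    ∀ x ∈ I.boundary V, ∃ v : TangentSpace I x, ℓ (mfderiv I J g x v) ≠ 0

/-- `f₀` and `f₁` are isotopic relative to the boundary, through proper embeddings. -/
def IsotopicRelBoundary (f₀ f₁ : V → P) : Prop :=
  ∃ F : ℝ → V → P,
    ContMDiffOn (𝓘(ℝ, ℝ).prod I) J ∞ (fun q : ℝ × V => F q.1 q.2) (Icc 0 1 ×ˢ univ) ∧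
    (∀ t ∈ Icc (0 : ℝ) 1, IsProperEmbedding I J (F t)) ∧
    F 0 = f₀ ∧ F 1 = f₁ ∧
    ∀ t ∈ Icc (0 : ℝ) 1, ∀ x ∈ I.boundary V, F t x = f₀ x

end Embeddings

section OpenBooks

variable {E : Type*} [NormedAddCommGroup E] [NormedSpace ℝ E] {H : Type*} [TopologicalSpace H]
  {E' : Type*} [NormedAddCommGroup E'] [NormedSpace ℝ E'] {H' : Type*} [TopologicalSpace H']

/-- A monodromy map of the page `V`: a self-diffeomorphism of `V` that is the identity on a
neighbourhood of `∂V`. The pair of `V` and `φ` is an abstract open book. -/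
structure Monodromy (I : ModelWithCorners ℝ E H) (V : Type*) [TopologicalSpace V]
    [ChartedSpace H V] where
  toDiffeo : V ≃ₘ^∞⟮I, I⟯ V
  eq_near_boundary : ∀ᶠ x in 𝓝ˢ (I.boundary V), toDiffeo x = x

namespace Monodromy

variable {I : ModelWithCorners ℝ E H} {V : Type*} [TopologicalSpace V] [ChartedSpace H V]

noncomputable instance : CoeFun (Monodromy I V) (fun _ => V → V) := ⟨fun φ => φ.toDiffeo⟩

/-- The underlying permutation of the page. -/
noncomputable def toPerm (φ : Monodromy I V) : Equiv.Perm V := φ.toDiffeo.toEquiv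

theorem contMDiff_zpow (φ : Monodromy I V) (k : ℤ) :
    ContMDiff I I ∞ (φ.toPerm ^ k : Equiv.Perm V) := by
  have h1 : ContMDiff I I ∞ φ.toPerm := φ.toDiffeo.contMDiff_toFun
  have h2 : ContMDiff I I ∞ (φ.toPerm⁻¹ : Equiv.Perm V) := φ.toDiffeo.contMDiff_invFun
  induction k with
  | zero => simpa using contMDiff_id
  | succ n ih => rw [zpow_add_one, Equiv.Perm.coe_mul]; exact ih.comp h1
  | pred n ih => rw [zpow_sub_one, Equiv.Perm.coe_mul]; exact ih.comp h2

/-- The `k`-fold composition of a monodromy map, for an arbitrary integer `k`. -/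
noncomputable def zpow (φ : Monodromy I V) (k : ℤ) : Monodromy I V where
  toDiffeo :=
    { toEquiv := φ.toPerm ^ k
      contMDiff_toFun := φ.contMDiff_zpow k
      contMDiff_invFun := by
        have h := φ.contMDiff_zpow (-k)
        rw [zpow_neg] at h
        exact h }
  eq_near_boundary :=
    φ.eq_near_boundary.mono fun _ hx => Equiv.Perm.zpow_apply_eq_self_of_apply_eq_self hx k

end Monodromy

/-- The smooth structure of the boundary `∂V` as a submanifold of `V`: a smooth structure on the
subspace `∂V`, of dimension one less than `V`, for which the inclusion is a smooth embedding. -/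
structure BoundaryStructure (I : ModelWithCorners ℝ E H) (V : Type*) [TopologicalSpace V]
    [ChartedSpace H V] where
  [chartedSpace : ChartedSpace (EuclideanSpace ℝ (Fin (finrank ℝ E - 1))) (I.boundary V)]
  [isManifold : IsManifold (𝓡 (finrank ℝ E - 1)) ∞ (I.boundary V)]
  isDiffEmbedding : IsDiffEmbedding (𝓡 (finrank ℝ E - 1)) I (Subtype.val : I.boundary V → V)

/-- An open book decomposition of the closed manifold `N` with page `V` and monodromy `φ`, i.e. an
identification of `N` with the union of the mapping torus of `φ` and `∂V × D²`, glued along their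
common boundary `∂V × S¹` by the identity.

The mapping torus is `V × ℝ` modulo `(x, t + 1) ∼ (φ x, t)`. It enters `N` by a smooth map `page`
on `V × ℝ` that identifies exactly the equivalent points and whose differential is bijective
everywhere; `D²` is the closed unit disc of `ℂ`, and `∂V × D²` enters by a smooth injective map
`tube` whose differential is bijective everywhere. -/
structure OpenBookDecomposition (I : ModelWithCorners ℝ E H) {V : Type*} [TopologicalSpace V]
    [ChartedSpace H V] (φ : Monodromy I V) (J : ModelWithCorners ℝ E' H') (N : Type*)
    [TopologicalSpace N] [ChartedSpace H' N] extends BoundaryStructure I V where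
  page : V × ℝ → N
  tube : I.boundary V × ℂ → N
  page_smooth : ContMDiff (I.prod 𝓘(ℝ, ℝ)) J ∞ page
  page_mfderiv : ∀ p, Function.Bijective (mfderiv (I.prod 𝓘(ℝ, ℝ)) J page p)
  page_eq_iff : ∀ x y : V, ∀ s t : ℝ,
    page (x, s) = page (y, t) ↔ ∃ m : ℤ, s = t + m ∧ y = φ.zpow m x
  tube_smooth : ContMDiffOn ((𝓡 (finrank ℝ E - 1)).prod 𝓘(ℝ, ℂ)) J ∞ tube
    (univ ×ˢ Metric.closedBall 0 1)
  tube_mfderiv : ∀ p ∈ (univ ×ˢ Metric.closedBall 0 1 : Set (I.boundary V × ℂ)),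
    Function.Bijective (mfderivWithin ((𝓡 (finrank ℝ E - 1)).prod 𝓘(ℝ, ℂ)) J tube
      (univ ×ˢ Metric.closedBall 0 1) p)
  tube_injOn : InjOn tube (univ ×ˢ Metric.closedBall 0 1)
  glue : ∀ (b : I.boundary V) (t : ℝ),
    page (b, t) = tube (b, Complex.exp (2 * Real.pi * t * Complex.I))
  disjoint : ∀ (p : V × ℝ) (b : I.boundary V) (z : ℂ), ‖z‖ < 1 → page p ≠ tube (b, z)
  cover : range page ∪ tube '' (univ ×ˢ Metric.closedBall 0 1) = univ

/-- The open book with page `V` and monodromy `φ` spun embeds in the one with page `P` and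
monodromy `ρ`: for some proper embedding `g` of `V` in `P`, the embeddings `g ∘ φ` and `ρ ∘ g` are
isotopic relative to the boundary. -/
def SpunEmbeds {I : ModelWithCorners ℝ E H} {J : ModelWithCorners ℝ E' H'}
    {V : Type*} [TopologicalSpace V] [ChartedSpace H V]
    {P : Type*} [TopologicalSpace P] [ChartedSpace H' P]
    (φ : Monodromy I V) (ρ : Monodromy J P) : Prop :=
  ∃ g : V → P, IsProperEmbedding I J g ∧ IsotopicRelBoundary I J (g ∘ φ) (ρ ∘ g)

end OpenBooks

end SpunEmbedding

/-! The binding component `B` has a collar `Ψ : B × [0, ε] → P` inside the set of fixed points of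
`ρ`. Any map of the page `V` into that collar satisfies `ρ ∘ g = g`, so it remains to embed `V`
there properly and to deform `g ∘ φ ^ k` to `g`. The open book of `B` supplies the deformation:
turning the page once around the binding returns it to itself up to `φ`.

Write `g_τ x = Ψ (spin τ x, depth x)`, where `spin τ x` lies in `B` and `depth x` measures the
distance to `∂V`. Away from `∂V`, `spin τ` is the page at angle `τ`. Near `∂V` it runs in the tube
`∂V × D²` along the segment from `1` to `exp (2πiτ)`, so it does not depend on `τ` on `∂V` itself.
For an integer `k` the segment is constant, and the relation defining the mapping torus gives `g_k =
g_0 ∘ φ ^ k` (`spin_intCast`). As `t` runs from `0` to `1`, `τ = k (1 - t)` gives the isotopy.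

The work lies in showing that every `g_τ` is a smooth proper embedding
(`isProperEmbedding_collar_spin`). The collar of `∂V` used by `spin` has length zero at the start,
so room is made by a squash `K` that retracts a neighbourhood of `∂V` onto `∂V`
(`exists_boundary_squash`). What `K` forgets is remembered by `depth`. With `level` the boundary
defining function in units of `δ`, the stages are: up to `1/2` the segment is traversed, up to `1`
the page is still squashed to the boundary, from `1` to `2` the squash relaxes to the identity, from
`3` to `4` the depth becomes constant, and below `5` the monodromy is the identity. Since depth is
constant beyond `4`, it is invariant under `φ`.

Immersions are handled through `IncrBigO`: a map is expanding at a point if increments in a chart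
are bounded by increments of the map. This relation composes like an inequality, makes sense at
boundary points, is an open condition, and yields both local injectivity and injectivity of the
differential. The main estimates of this kind are `squash_incrBigO`, `collar_incrBigO` and
`spin_depth_incrBigO`. -/

namespace SpunEmbedding
open Filter Asymptotics

/-! ### Increment estimates, a quantitative form of being an immersion -/

section Increments

variable {X Y E F G : Type*} [NormedAddCommGroup E] [NormedAddCommGroup F] [NormedAddCommGroup G]

/-- The increments `a x - a y` are `O(b x - b y)` as `x` and `y` both tend along `l`. -/
def IncrBigO (l : Filter X) (a : X → E) (b : X → F) : Prop :=
  (fun q : X × X => a q.1 - a q.2) =O[l ×ˢ l] fun q : X × X => b q.1 - b q.2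

namespace IncrBigO

variable {l l' : Filter X} {a : X → E} {b : X → F} {c : X → G}

theorem const (l : Filter X) (e : E) (b : X → F) : IncrBigO l (fun _ => e) b := by
  simp only [IncrBigO, sub_self]
  exact isBigO_zero _ _

theorem trans (h : IncrBigO l a b) (h' : IncrBigO l b c) : IncrBigO l a c := IsBigO.trans h h'

theorem mono (h : IncrBigO l a b) (hl : l' ≤ l) : IncrBigO l' a b :=
  IsBigO.mono h (prod_mono hl hl)

theorem comp_tendsto {m : Filter Y} {k : Y → X} (h : IncrBigO l a b) (hk : Tendsto k m l) :
    IncrBigO m (a ∘ k) (b ∘ k) :=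
  IsBigO.comp_tendsto h (hk.prodMap hk)

theorem congr' {a' : X → E} {b' : X → F} (h : IncrBigO l a b) (ha : a =ᶠ[l] a')
    (hb : b =ᶠ[l] b') : IncrBigO l a' b' := by
  refine IsBigO.congr' h ?_ ?_
  · filter_upwards [ha.prod_mk ha] with q hq
    rw [hq.1, hq.2]
  · filter_upwards [hb.prod_mk hb] with q hq
    rw [hq.1, hq.2]

theorem prodMk (h : IncrBigO l a c) (h' : IncrBigO l b c) :
    IncrBigO l (fun x => (a x, b x)) c :=
  IsBigO.prod_left h h'

theorem fst {a : X → E × F} (l : Filter X) : IncrBigO l (fun x => (a x).1) a :=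
  IsBigO.of_bound' (Eventually.of_forall fun q => norm_fst_le (a q.1 - a q.2))

theorem snd {a : X → E × F} (l : Filter X) : IncrBigO l (fun x => (a x).2) a :=
  IsBigO.of_bound' (Eventually.of_forall fun q => norm_snd_le (a q.1 - a q.2))

/-- Equal values of `b` make the bound on the increment of `a` vanish. With `a` a chart, an
expanding map is locally injective. -/
theorem eventually_injOn (h : IncrBigO l a b) (ha : ∃ s ∈ l, InjOn a s) :
    ∃ s ∈ l, InjOn b s := by
  obtain ⟨s, hs, hsa⟩ := ha
  obtain ⟨C, hC⟩ := h.bound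
  obtain ⟨t, ht, htC⟩ := mem_prod_same_iff.1 hC
  refine ⟨s ∩ t, inter_mem hs ht, fun x hx y hy hxy => hsa hx.1 hy.1 ?_⟩
  have := htC (show (x, y) ∈ t ×ˢ t from ⟨hx.2, hy.2⟩)
  simp only [mem_ofPred_eq, hxy, sub_self, norm_zero, mul_zero] at this
  exact sub_eq_zero.1 (norm_le_zero_iff.1 this)

end IncrBigO

end Increments

section Vector

variable {E F : Type*} [NormedAddCommGroup E] [NormedSpace ℝ E] [NormedAddCommGroup F]
  [NormedSpace ℝ F]

/-- The derivative `L` at `z` is antilipschitz with some constant `K`, and by the mean value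
inequality on the convex set `C` the remainder `g - L` has Lipschitz constant `K⁻¹ / 2` near `z`.
The remainder therefore absorbs at most half of the expansion. Injectivity is asked of every
derivative within `C`, so uniqueness of the derivative plays no role. -/
theorem incrBigO_id_of_contDiffWithinAt [FiniteDimensional ℝ E] {g : E → F} {C : Set E} {z : E}
    (hC : Convex ℝ C) (hz : z ∈ C) (hg : ContDiffWithinAt ℝ 1 g C z)
    (hinj : ∀ g' : E →L[ℝ] F, HasFDerivWithinAt g g' C z → ∀ v, g' v = 0 → v = 0) :
    IncrBigO (𝓝[C] z) id g := by
  obtain ⟨u, hu, -, -, f', hf', hc⟩ :=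
    (contDiffWithinAt_succ_iff_hasFDerivWithinAt' (n := 0) (by simp)).1
      (show ContDiffWithinAt ℝ (0 + 1) g C z by simpa using hg)
  rw [insert_eq_of_mem hz] at hu
  have hzu : z ∈ u := mem_of_mem_nhdsWithin hz hu
  set L := f' z with hL
  have hL0 := hinj L (hf' z hzu)
  obtain ⟨K, K0, hK⟩ := (L : E →ₗ[ℝ] F).exists_antilipschitzWith
    (LinearMap.ker_eq_bot'.2 hL0)
  have hKK : (0 : NNReal) < K⁻¹ / 2 := by positivity
  obtain ⟨t, ht, hlip⟩ := hC.exists_nhdsWithin_lipschitzOnWith_of_hasFDerivWithinAt_of_nnnorm_lt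
    (f := fun y => g y - L y) (f' := fun y => f' y - L) (x := z)
    (by filter_upwards [hu] with y hy using (hf' y hy).sub L.hasFDerivWithinAt)
    (hc.continuousWithinAt.sub continuousWithinAt_const) (K⁻¹ / 2) (by simpa [hL] using hKK)
  refine IsBigO.of_bound (2 * K) ?_
  filter_upwards [prod_mem_prod ht ht] with q hq
  have h1 := hlip.norm_sub_le hq.1 hq.2
  have h2 : ‖q.1 - q.2‖ ≤ K * ‖L (q.1 - q.2)‖ := by
    have := hK.le_mul_dist q.1 q.2
    rw [dist_eq_norm, dist_eq_norm] at this
    simpa using this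
  have h3 : ‖L (q.1 - q.2)‖ ≤ ‖g q.1 - g q.2‖ + (K : ℝ)⁻¹ / 2 * ‖q.1 - q.2‖ := by
    have : L (q.1 - q.2) = (g q.1 - g q.2) - ((g q.1 - L q.1) - (g q.2 - L q.2)) := by
      rw [map_sub]; abel
    rw [this]
    refine (norm_sub_le _ _).trans ?_
    gcongr
    simpa using h1
  have K0' : (0 : ℝ) < K := K0
  have h4 : ‖q.1 - q.2‖ ≤ K * ‖g q.1 - g q.2‖ + ‖q.1 - q.2‖ / 2 := by
    refine (h2.trans (mul_le_mul_of_nonneg_left h3 K0'.le)).trans (le_of_eq ?_)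
    field_simp
  simp only [id]
  linarith

theorem incrBigO_of_contDiffWithinAt {g : E → F} {C : Set E} {z : E}
    (hC : Convex ℝ C) (hg : ContDiffWithinAt ℝ 1 g C z) : IncrBigO (𝓝[C] z) g id := by
  obtain ⟨K, t, ht, hlip⟩ := hg.exists_lipschitzOnWith hC
  refine IsBigO.of_bound K ?_
  filter_upwards [prod_mem_prod ht ht] with q hq using hlip.norm_sub_le hq.1 hq.2

end Vector

/-! ### Increment estimates in the charts of a manifold -/

section Charts

variable {E : Type*} [NormedAddCommGroup E] [NormedSpace ℝ E] {H : Type*} [TopologicalSpace H]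
  {I : ModelWithCorners ℝ E H} {M : Type*} [TopologicalSpace M] [ChartedSpace H M]
  {F : Type*} [NormedAddCommGroup F] [NormedSpace ℝ F]

theorem tendsto_extChartAt_nhdsWithin {S : Set M} {p x : M} (hx : x ∈ (extChartAt I p).source) :
    Tendsto (extChartAt I p) (𝓝[S] x)
      (𝓝[(extChartAt I p).symm ⁻¹' S ∩ range I] (extChartAt I p x)) := by
  refine tendsto_nhdsWithin_iff.2
    ⟨(continuousAt_extChartAt' hx).tendsto.mono_left nhdsWithin_le_nhds, ?_⟩
  filter_upwards [nhdsWithin_le_nhds (extChartAt_source_mem_nhds' hx), self_mem_nhdsWithin]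
    with y hy hyS
  refine ⟨?_, extChartAt_target_subset_range p ((extChartAt I p).map_source hy)⟩
  rwa [mem_preimage, (extChartAt I p).left_inv hy]

theorem contDiffWithinAt_comp_extChartAt_symm [IsManifold I 1 M] {S : Set M} {p x : M} {a : M → F}
    (hx : x ∈ (extChartAt I p).source) (ha : ContMDiffWithinAt I 𝓘(ℝ, F) 1 a S x) :
    ContDiffWithinAt ℝ 1 (a ∘ (extChartAt I p).symm) ((extChartAt I p).symm ⁻¹' S ∩ range I)
      (extChartAt I p x) := by
  rw [extChartAt_source] at hx
  exact ((contMDiffWithinAt_iff_source_of_mem_source hx).1 ha).contDiffWithinAt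

theorem IncrBigO.of_comp_extChartAt_symm {S : Set M} {p x : M} {F G : Type*}
    [NormedAddCommGroup F] [NormedAddCommGroup G] {a : M → F} {b : M → G}
    (hx : x ∈ (extChartAt I p).source)
    (h : IncrBigO (𝓝[(extChartAt I p).symm ⁻¹' S ∩ range I] (extChartAt I p x))
      (a ∘ (extChartAt I p).symm) (b ∘ (extChartAt I p).symm)) : IncrBigO (𝓝[S] x) a b := by
  have key : (extChartAt I p).symm ∘ extChartAt I p =ᶠ[𝓝[S] x] id := by
    filter_upwards [nhdsWithin_le_nhds (extChartAt_source_mem_nhds' hx)] with y hy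
      using (extChartAt I p).left_inv hy
  exact (h.comp_tendsto (tendsto_extChartAt_nhdsWithin hx)).congr' (key.fun_comp a)
    (key.fun_comp b)

theorem eventuallyEq_extChartAt_comp_symm {S : Set M} {p x : M}
    (hx : x ∈ (extChartAt I p).source) :
    extChartAt I p ∘ (extChartAt I p).symm
      =ᶠ[𝓝[(extChartAt I p).symm ⁻¹' S ∩ range I] (extChartAt I p x)] id := by
  filter_upwards [nhdsWithin_mono _ inter_subset_right (extChartAt_target_mem_nhdsWithin' hx)]
    with z hz using (extChartAt I p).right_inv hz

/-- Maps of class `C¹` are locally Lipschitz in charts. -/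
theorem incrBigO_extChartAt_of_contMDiffWithinAt [IsManifold I 1 M] {S : Set M} {p x : M}
    {a : M → F} (hx : x ∈ (extChartAt I p).source)
    (hS : Convex ℝ ((extChartAt I p).symm ⁻¹' S ∩ range I))
    (ha : ContMDiffWithinAt I 𝓘(ℝ, F) 1 a S x) :
    IncrBigO (𝓝[S] x) a (extChartAt I p) := by
  refine IncrBigO.of_comp_extChartAt_symm hx ?_
  exact (incrBigO_of_contDiffWithinAt hS (contDiffWithinAt_comp_extChartAt_symm hx ha)).congr'
    EventuallyEq.rfl (eventuallyEq_extChartAt_comp_symm hx).symm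

theorem extChartAt_incrBigO_of_contMDiffWithinAt [IsManifold I 1 M] [FiniteDimensional ℝ E]
    {S : Set M} {p x : M} {a : M → F} (hx : x ∈ (extChartAt I p).source) (hxS : x ∈ S)
    (hS : Convex ℝ ((extChartAt I p).symm ⁻¹' S ∩ range I))
    (ha : ContMDiffWithinAt I 𝓘(ℝ, F) 1 a S x)
    (hinj : ∀ g' : E →L[ℝ] F, HasFDerivWithinAt (a ∘ (extChartAt I p).symm) g'
      ((extChartAt I p).symm ⁻¹' S ∩ range I) (extChartAt I p x) → ∀ v, g' v = 0 → v = 0) :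
    IncrBigO (𝓝[S] x) (extChartAt I p) a := by
  refine IncrBigO.of_comp_extChartAt_symm hx ?_
  refine (incrBigO_id_of_contDiffWithinAt hS ?_ (contDiffWithinAt_comp_extChartAt_symm hx ha)
    hinj).congr' (eventuallyEq_extChartAt_comp_symm hx).symm EventuallyEq.rfl
  exact ⟨by rwa [mem_preimage, (extChartAt I p).left_inv hx],
    extChartAt_target_subset_range p ((extChartAt I p).map_source hx)⟩

theorem contMDiffAt_extChartAt_of_mem_source {n : WithTop ℕ∞} [IsManifold I n M] {p x : M}
    (hx : x ∈ (extChartAt I p).source) : ContMDiffAt I 𝓘(ℝ, E) n (extChartAt I p) x :=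
  contMDiffAt_extChartAt' (by rwa [extChartAt_source] at hx)

end Charts

/-! ### Derivatives tested along inward rays -/

section VectorDerivative

variable {E F : Type*} [NormedAddCommGroup E] [NormedSpace ℝ E] [NormedAddCommGroup F]
  [NormedSpace ℝ F] {g : E → F} {g' : E →L[ℝ] F} {C : Set E} {z v : E}

theorem tendsto_add_smul_nhdsWithin (hv : ∀ᶠ t : ℝ in 𝓝[≥] 0, z + t • v ∈ C) :
    Tendsto (fun t : ℝ => z + t • v) (𝓝[≥] 0) (𝓝[C] z) := by
  refine tendsto_nhdsWithin_iff.2 ⟨?_, hv⟩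
  have : Continuous fun t : ℝ => z + t • v := by fun_prop
  simpa using (this.tendsto 0).mono_left nhdsWithin_le_nhds

theorem hasDerivWithinAt_comp_add_smul (hg : HasFDerivWithinAt g g' C z)
    (hv : ∀ᶠ t : ℝ in 𝓝[≥] 0, z + t • v ∈ C) :
    HasDerivWithinAt (fun t : ℝ => g (z + t • v)) (g' v) (Ici 0) 0 := by
  have hl : HasDerivWithinAt (fun t : ℝ => z + t • v) v
      (Ici 0 ∩ (fun t : ℝ => z + t • v) ⁻¹' C) 0 := by
    have := (((hasDerivAt_id (0 : ℝ)).smul_const v).const_add z).hasDerivWithinAt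
      (s := Ici 0 ∩ (fun t : ℝ => z + t • v) ⁻¹' C)
    simpa using this
  have := HasFDerivWithinAt.comp_hasDerivWithinAt (0 : ℝ) (t := C) (l := g) (l' := g')
    (f := fun t : ℝ => z + t • v) (by simpa using hg) hl (fun t ht => ht.2)
  exact this.mono_of_mem_nhdsWithin (inter_mem self_mem_nhdsWithin hv)

theorem HasFDerivWithinAt.apply_eq_of_eventuallyEq (hg : HasFDerivWithinAt g g' C z) {u : F}
    (hv : ∀ᶠ t : ℝ in 𝓝[≥] 0, z + t • v ∈ C)
    (hu : ∀ᶠ t : ℝ in 𝓝[≥] 0, g (z + t • v) = g z + t • u) : g' v = u := by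
  have h1 := hasDerivWithinAt_comp_add_smul hg hv
  have h2 : HasDerivWithinAt (fun t : ℝ => g z + t • u) u (Ici 0) 0 := by
    simpa using (((hasDerivAt_id (0 : ℝ)).smul_const u).const_add (g z)).hasDerivWithinAt
  have h3 : HasDerivWithinAt (fun t : ℝ => g (z + t • v)) u (Ici 0) 0 :=
    h2.congr_of_eventuallyEq hu (by simp)
  exact (uniqueDiffOn_Ici (0 : ℝ) 0 (mem_Ici.2 le_rfl)).eq_deriv _ h1 h3

/-- At a boundary point only inward rays stay in the domain. A linear lower bound along such a ray
bounds the difference quotients for `t > 0`, hence their limit. -/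
theorem HasFDerivWithinAt.apply_nonneg {g : E → ℝ} {g' : E →L[ℝ] ℝ} {a : ℝ}
    (hg : HasFDerivWithinAt g g' C z)
    (hv : ∀ᶠ t : ℝ in 𝓝[≥] 0, z + t • v ∈ C) (hz : g z = 0)
    (hu : ∀ᶠ t : ℝ in 𝓝[≥] 0, t * a ≤ g (z + t • v)) : a ≤ g' v := by
  have h1 := hasDerivWithinAt_comp_add_smul hg hv
  have h2 := (hasDerivWithinAt_iff_tendsto_slope.1 h1)
  rw [Ici_sdiff_left] at h2
  refine ge_of_tendsto h2 ?_
  filter_upwards [nhdsWithin_mono _ Ioi_subset_Ici_self hu, self_mem_nhdsWithin] with t ht ht0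
  rw [slope_def_field]
  simp only [zero_smul, add_zero, hz, sub_zero]
  rw [le_div_iff₀ ht0]
  linarith

/-- If `g' v = 0`, the increment of `g` along the ray is `o(t)`. The estimate then makes `t • v`
itself `o(t)`. -/
theorem HasFDerivWithinAt.eq_zero_of_incrBigO (hg : HasFDerivWithinAt g g' C z)
    (hzC : z ∈ C) (h : IncrBigO (𝓝[C] z) id g)
    (hv : ∀ᶠ t : ℝ in 𝓝[≥] 0, z + t • v ∈ C) (h0 : g' v = 0) : v = 0 := by
  have h1 := hasDerivWithinAt_comp_add_smul hg hv
  rw [h0] at h1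
  have h2 := hasDerivWithinAt_iff_isLittleO.1 h1
  simp only [sub_zero, smul_zero, zero_smul, add_zero] at h2
  have ht := (tendsto_add_smul_nhdsWithin hv).prodMk
    (tendsto_const_nhdsWithin hzC : Tendsto (fun _ => z) _ (𝓝[C] z))
  have h3 := (IsBigO.comp_tendsto h ht)
  have h4 : (fun t : ℝ => t • v) =o[𝓝[≥] 0] fun t => t := by
    refine IsBigO.trans_isLittleO ?_ h2
    simpa [Function.comp_def] using h3
  by_contra hne
  have h5 : (fun t : ℝ => t) =o[𝓝[≥] 0] fun t : ℝ => t := by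
    refine IsBigO.trans_isLittleO (IsBigO.of_bound ‖v‖⁻¹ (Eventually.of_forall fun t => ?_)) h4
    rw [norm_smul]
    have : 0 < ‖v‖ := norm_pos_iff.2 hne
    field_simp
    exact le_rfl
  have h6 := (isLittleO_irrefl' (f' := fun t : ℝ => t) (l := 𝓝[>] (0 : ℝ)) (by
    refine Eventually.frequently ?_
    filter_upwards [self_mem_nhdsWithin] with t ht
    exact norm_ne_zero_iff.2 (ne_of_gt ht)))
  exact h6 (h5.mono (nhdsWithin_mono _ Ioi_subset_Ici_self))

end VectorDerivative

/-! ### Boundary points and heights in half-space charts -/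

section HalfSpace

variable {E : Type*} [NormedAddCommGroup E] [NormedSpace ℝ E] {H : Type*} [TopologicalSpace H]
  {I : ModelWithCorners ℝ E H} {M : Type*} [TopologicalSpace M] [ChartedSpace H M]
  {F : Type*} [NormedAddCommGroup F] [NormedSpace ℝ F] {ℓ : E →L[ℝ] ℝ}

theorem surjective_of_ne_zero (h0 : ℓ ≠ 0) : Function.Surjective ℓ :=
  LinearMap.surjective fun h => h0 (ContinuousLinearMap.coe_injective h)

theorem frontier_halfSpace [CompleteSpace E] (h0 : ℓ ≠ 0) :
    frontier {x : E | 0 ≤ ℓ x} = {x | ℓ x = 0} := by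
  have hs := surjective_of_ne_zero h0
  have : {x : E | 0 ≤ ℓ x} = ℓ ⁻¹' Ici 0 := rfl
  rw [this, ContinuousLinearMap.frontier_preimage ℓ hs, frontier_Ici]
  rfl

theorem apply_extChartAt_nonneg (hℓ : range I = {x | 0 ≤ ℓ x}) {p x : M}
    (hx : x ∈ (extChartAt I p).source) : 0 ≤ ℓ (extChartAt I p x) := by
  have := extChartAt_target_subset_range p ((extChartAt I p).map_source hx)
  rwa [hℓ] at this

theorem ne_zero_of_mem_boundary (hℓ : range I = {x | 0 ≤ ℓ x}) {x : M} (hx : x ∈ I.boundary M) :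
    ℓ ≠ 0 := by
  rintro rfl
  have : I.IsBoundaryPoint x := hx
  rw [ModelWithCorners.isBoundaryPoint_iff, hℓ] at this
  simp at this

/-- The boundary is defined through the preferred chart at `x`. By invariance under changes of chart
it can be read off in the chart at any `p`, where it is the frontier of the half-space. -/
theorem mem_boundary_iff [FiniteDimensional ℝ E] [IsManifold I 1 M]
    (hℓ : range I = {x | 0 ≤ ℓ x}) (h0 : ℓ ≠ 0) {p x : M}
    (hx : x ∈ (extChartAt I p).source) : x ∈ I.boundary M ↔ ℓ (extChartAt I p x) = 0 := by
  have : CompleteSpace E := FiniteDimensional.complete ℝ E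
  have hx' : x ∈ (chartAt H p).source := by rwa [extChartAt_source] at hx
  have h := ModelWithCorners.isInteriorPoint_iff_of_mem_atlas (I := I) (n := 1) one_ne_zero
    (chart_mem_atlas H p) hx'
  have h1 : extChartAt I p x ∈ interior (extChartAt I p).target ↔
      extChartAt I p x ∈ interior (range I) :=
    ⟨fun h => interior_mono (extChartAt_target_subset_range p) h,
      (chartAt H p).mem_interior_extend_target ((chartAt H p).map_source hx')⟩
  have h2 : I.IsBoundaryPoint x ↔ extChartAt I p x ∉ interior (range I) := by
    rw [← h1, ModelWithCorners.isBoundaryPoint_iff_not_isInteriorPoint, not_iff_not]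
    exact h
  refine h2.trans ?_
  have h3 : extChartAt I p x ∈ range I :=
    extChartAt_target_subset_range p ((extChartAt I p).map_source hx)
  rw [mem_interior_iff_notMem_frontier h3, not_not, hℓ, frontier_halfSpace h0]
  rfl

variable [FiniteDimensional ℝ E] [IsManifold I 1 M]

/-- A `C¹` function that vanishes on the boundary is bounded by a multiple of the height of a
half-space chart. -/
theorem isBigO_height_of_eq_zero_on_boundary (hℓ : range I = {x | 0 ≤ ℓ x}) {p x : M}
    (hx : x ∈ I.boundary M) (hxp : x ∈ (extChartAt I p).source) {f : M → F}
    (hf : ContMDiffAt I 𝓘(ℝ, F) 1 f x) (hf0 : ∀ᶠ y in 𝓝 x, y ∈ I.boundary M → f y = 0) :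
    f =O[𝓝 x] fun y => ℓ (extChartAt I p y) := by
  have h0 := ne_zero_of_mem_boundary hℓ hx
  have hx0 := (mem_boundary_iff hℓ h0 hxp).1 hx
  obtain ⟨e, he⟩ : ∃ e, ℓ e = 1 := (surjective_of_ne_zero h0) 1
  set φ := extChartAt I p
  -- The projection along `e` to the boundary hyperplane: `f` vanishes at the projected point, which
  -- differs from `y` in the chart by exactly `ℓ (φ y) • e`, so the Lipschitz estimate for `f` gives
  -- the bound.
  set ζ : M → E := fun y => φ y - ℓ (φ y) • e with hζ
  have hζ0 : ∀ y, ℓ (ζ y) = 0 := fun y => by simp [hζ, he]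
  have hζc : Tendsto ζ (𝓝 x) (𝓝[range I] (φ x)) := by
    refine tendsto_nhdsWithin_iff.2 ⟨?_, Eventually.of_forall fun y => by
      rw [hℓ]; exact (hζ0 y).ge⟩
    have h1 : Tendsto φ (𝓝 x) (𝓝 (φ x)) := continuousAt_extChartAt' hxp
    have h2 := h1.sub (((ℓ.continuous.tendsto _).comp h1).smul_const e)
    simpa [hx0] using h2
  have hπ : Tendsto (fun y => φ.symm (ζ y)) (𝓝 x) (𝓝 x) := by
    have h1 : ContinuousAt φ.symm (φ x) := continuousAt_extChartAt_symm' hxp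
    have h2 := h1.tendsto
    rw [φ.left_inv hxp] at h2
    exact h2.comp (hζc.mono_right nhdsWithin_le_nhds)
  have htgt : ∀ᶠ y in 𝓝 x, ζ y ∈ φ.target := hζc (extChartAt_target_mem_nhdsWithin' hxp)
  have hlip := incrBigO_extChartAt_of_contMDiffWithinAt (S := univ) hxp
    (by rw [preimage_univ, univ_inter]; exact I.convex_range) hf.contMDiffWithinAt
  rw [nhdsWithin_univ] at hlip
  have h1 := IsBigO.comp_tendsto hlip (tendsto_id.prodMk hπ)
  have h2 : f =O[𝓝 x] fun y => ℓ (φ y) • e := by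
    refine h1.congr' ?_ ?_
    · filter_upwards [htgt, hπ.eventually hf0] with y hy hy0
      have : φ.symm (ζ y) ∈ I.boundary M := by
        rw [mem_boundary_iff hℓ h0 (φ.map_target hy)]
        change ℓ (φ _) = 0
        rw [φ.right_inv hy, hζ0]
      simp [hy0 this]
    · filter_upwards [htgt] with y hy
      change φ y - φ (φ.symm (ζ y)) = _
      rw [φ.right_inv hy]
      simp [hζ]
  refine h2.trans (IsBigO.of_bound ‖e‖ (Eventually.of_forall fun y => ?_))
  rw [norm_smul, mul_comm]

end HalfSpace

/-! ### From increment estimates to injective differentials -/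

section Immersive

variable {E : Type*} [NormedAddCommGroup E] [NormedSpace ℝ E] {H : Type*} [TopologicalSpace H]
  {I : ModelWithCorners ℝ E H} {M : Type*} [TopologicalSpace M] [ChartedSpace H M]
  {E' : Type*} [NormedAddCommGroup E'] [NormedSpace ℝ E'] {H' : Type*} [TopologicalSpace H']
  {J : ModelWithCorners ℝ E' H'} {N : Type*} [TopologicalSpace N] [ChartedSpace H' N]
  {f : M → N} {x : M}

/-- One of `v` and `-v` does not point out of the half-space. That suffices for testing kernels,
which are closed under negation. -/
theorem eventually_add_smul_mem_range [IsHalfSpaceModel I] {z : E} (hz : z ∈ range I) (v : E) :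
    (∀ t : ℝ, 0 ≤ t → z + t • v ∈ range I) ∨ (∀ t : ℝ, 0 ≤ t → z + t • (-v) ∈ range I) := by
  obtain ⟨ℓ, hℓ⟩ := IsHalfSpaceModel.exists_range_eq (I := I)
  rw [hℓ] at hz ⊢
  have hz' : 0 ≤ ℓ z := hz
  rcases le_total 0 (ℓ v) with h | h
  · left
    intro t ht
    simp only [mem_ofPred_eq, map_add, map_smul, smul_eq_mul]
    positivity
  · right
    intro t ht
    simp only [mem_ofPred_eq, map_add, map_smul, smul_eq_mul, map_neg]
    have := mul_nonneg ht (neg_nonneg.2 h)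
    linarith

theorem mfderiv_injective_of_incrBigO [IsHalfSpaceModel I] (hf : MDifferentiableAt I J f x)
    (h : IncrBigO (𝓝 x) (extChartAt I x) (extChartAt J (f x) ∘ f)) :
    Function.Injective (mfderiv I J f x) := by
  have hd := hf.hasMFDerivAt.2
  set g' : E →L[ℝ] E' := mfderiv I J f x
  set z := extChartAt I x x with hz
  have hzr : z ∈ range I := mem_range_self _
  have h1 : IncrBigO (𝓝[range I] z) id (writtenInExtChartAt I J x f) := by
    have := h.comp_tendsto (map_extChartAt_symm_nhdsWithin_range (I := I) x).le
    refine this.congr' ?_ EventuallyEq.rfl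
    have := eventuallyEq_extChartAt_comp_symm (I := I) (S := univ) (mem_extChartAt_source (I := I) x)
    rwa [preimage_univ, univ_inter] at this
  refine (injective_iff_map_eq_zero g').2 fun v hv => ?_
  rcases eventually_add_smul_mem_range hzr v with hc | hc
  · exact HasFDerivWithinAt.eq_zero_of_incrBigO hd hzr h1
      (by filter_upwards [self_mem_nhdsWithin] with t ht using hc t ht) hv
  · have hv' : g' (-v) = 0 := by rw [map_neg, hv, neg_zero]
    exact neg_eq_zero.1 (HasFDerivWithinAt.eq_zero_of_incrBigO hd hzr h1
      (by filter_upwards [self_mem_nhdsWithin] with t ht using hc t ht) hv')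

end Immersive

/-! ### Moving points transversally to the boundary, one bump function at a time -/

section Shift

variable {E : Type*} [NormedAddCommGroup E] [NormedSpace ℝ E] [FiniteDimensional ℝ E]
  {H : Type*} [TopologicalSpace H]
  {I : ModelWithCorners ℝ E H} {M : Type*} [TopologicalSpace M] [ChartedSpace H M]
  {ℓ : E →L[ℝ] ℝ} {e : E} {α : ℝ → ℝ → ℝ} {c : M} {W : Set ℝ} {ε : ℝ}

open Classical in
/-- In the chart of the bump function `f`, move `y` in the direction `e` by the amount `f y * a`,
where `a = α h w` depends on the height `h` of `y` and on a parameter `w`. -/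
noncomputable def bumpShift (ℓ : E →L[ℝ] ℝ) (e : E) (α : ℝ → ℝ → ℝ) (f : SmoothBumpFunction I c)
    (y : M) (w : ℝ) : M :=
  if f y = 0 then y else
    (extChartAt I c).symm (extChartAt I c y + (f y * α (ℓ (extChartAt I c y)) w) • e)

/-- Shifts of size at most `ε` of the support of `f` that stay in the half-space stay in the
chart. -/
def ShiftsWithin (ℓ : E →L[ℝ] ℝ) (e : E) (ε : ℝ) (f : SmoothBumpFunction I c) : Prop :=
  ∀ y ∈ tsupport f, ∀ τ : ℝ, |τ| ≤ ε → 0 ≤ ℓ (extChartAt I c y + τ • e) →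
    extChartAt I c y + τ • e ∈ (extChartAt I c).target

/-- The amounts of the shift are at most `ε` and do not leave the half-space. -/
def IsShiftAmount (W : Set ℝ) (ε : ℝ) (α : ℝ → ℝ → ℝ) : Prop :=
  ∀ h : ℝ, 0 ≤ h → ∀ w ∈ W, -h ≤ α h w ∧ |α h w| ≤ ε

/-- The chart image of the support is compact, so it has a thickening inside the open set that cuts
the chart target out of the half-space. -/
theorem eventually_shiftsWithin [T2Space M] [CompactSpace M] (hℓ : range I = {x | 0 ≤ ℓ x})
    (f : SmoothBumpFunction I c) : ∀ᶠ ε in 𝓝[>] (0 : ℝ), ShiftsWithin ℓ e ε f := by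
  have hK : IsCompact (extChartAt I c '' tsupport f) :=
    (isClosed_tsupport f).isCompact.image_of_continuousOn
      ((continuousOn_extChartAt c).mono f.tsupport_subset_extChartAt_source)
  have htgt : (extChartAt I c).target = I.symm ⁻¹' (chartAt H c).target ∩ range I :=
    (chartAt H c).extend_target
  obtain ⟨δ, hδ, hsub⟩ := hK.exists_thickening_subset_open
    ((chartAt H c).open_target.preimage I.continuous_symm) (by
      rintro _ ⟨y, hy, rfl⟩
      have := (extChartAt I c).map_source (f.tsupport_subset_extChartAt_source hy)
      rw [htgt] at this
      exact this.1)
  have : ∀ᶠ ε in 𝓝[>] (0 : ℝ), ε * ‖e‖ < δ := by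
    have h : Tendsto (fun ε : ℝ => ε * ‖e‖) (𝓝[>] 0) (𝓝 (0 * ‖e‖)) :=
      (tendsto_id.mul_const _).mono_left nhdsWithin_le_nhds
    rw [zero_mul] at h
    exact h.eventually (gt_mem_nhds hδ)
  filter_upwards [this] with ε hε y hy τ hτ hpos
  rw [htgt]
  refine ⟨hsub ?_, by rw [hℓ]; exact hpos⟩
  refine Metric.mem_thickening_iff.2 ⟨_, mem_image_of_mem _ hy, ?_⟩
  rw [dist_eq_norm, add_sub_cancel_left, norm_smul]
  exact (mul_le_mul_of_nonneg_right hτ (norm_nonneg _)).trans_lt hε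

theorem bumpShift_of_eq_zero {f : SmoothBumpFunction I c} {y : M} {w : ℝ} (h : f y = 0) :
    bumpShift ℓ e α f y w = y := if_pos h

theorem bumpShift_of_mem_source {f : SmoothBumpFunction I c} {y : M} {w : ℝ}
    (hy : y ∈ (extChartAt I c).source) :
    bumpShift ℓ e α f y w =
      (extChartAt I c).symm (extChartAt I c y + (f y * α (ℓ (extChartAt I c y)) w) • e) := by
  unfold bumpShift
  split_ifs with h
  · rw [h, zero_mul, zero_smul, add_zero, (extChartAt I c).left_inv hy]
  · rfl

theorem mem_source_of_ne_zero {f : SmoothBumpFunction I c} {y : M} (h : f y ≠ 0) :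
    y ∈ (extChartAt I c).source := by
  rw [extChartAt_source]
  exact f.support_subset_source h

theorem bumpShift_of_amount_eq_zero {f : SmoothBumpFunction I c} {y : M} {w : ℝ}
    (h : α (ℓ (extChartAt I c y)) w = 0) : bumpShift ℓ e α f y w = y := by
  by_cases hf : f y = 0
  · exact bumpShift_of_eq_zero hf
  · have := mem_source_of_ne_zero hf
    rw [bumpShift_of_mem_source this, h, mul_zero, zero_smul, add_zero,
      (extChartAt I c).left_inv this]

theorem shift_mem_target (hℓ : range I = {x | 0 ≤ ℓ x}) (he : ℓ e = 1)
    {f : SmoothBumpFunction I c} (hf : ShiftsWithin ℓ e ε f) (hα : IsShiftAmount W ε α)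
    {y : M} (hy : y ∈ (extChartAt I c).source) {w : ℝ} (hw : w ∈ W) :
    extChartAt I c y + (f y * α (ℓ (extChartAt I c y)) w) • e ∈ (extChartAt I c).target := by
  by_cases h0 : f y = 0
  · simpa [h0] using (extChartAt I c).map_source hy
  · have hh := apply_extChartAt_nonneg hℓ hy
    obtain ⟨h1, h2⟩ := hα _ hh w hw
    refine hf y (subset_tsupport f h0) _ ?_ ?_
    · rw [abs_mul, abs_of_nonneg f.nonneg]
      exact (mul_le_of_le_one_left (abs_nonneg _) f.le_one).trans h2
    · simp only [map_add, map_smul, he, smul_eq_mul, mul_one]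
      -- With `h` the height and `a ≥ -h` the amount, `0 ≤ f y ≤ 1` gives `h + f y * a ≥ h - f y * h
      -- ≥ 0`.
      have := mul_le_mul_of_nonneg_left h1 (f.nonneg (x := y))
      nlinarith [f.le_one (x := y)]

theorem bumpShift_mem_source (hℓ : range I = {x | 0 ≤ ℓ x}) (he : ℓ e = 1)
    {f : SmoothBumpFunction I c} (hf : ShiftsWithin ℓ e ε f) (hα : IsShiftAmount W ε α)
    {y : M} (hy : y ∈ (extChartAt I c).source) {w : ℝ} (hw : w ∈ W) :
    bumpShift ℓ e α f y w ∈ (extChartAt I c).source := by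
  rw [bumpShift_of_mem_source hy]
  exact (extChartAt I c).map_target (shift_mem_target hℓ he hf hα hy hw)

theorem height_bumpShift (hℓ : range I = {x | 0 ≤ ℓ x}) (he : ℓ e = 1)
    {f : SmoothBumpFunction I c} (hf : ShiftsWithin ℓ e ε f) (hα : IsShiftAmount W ε α)
    {y : M} (hy : y ∈ (extChartAt I c).source) {w : ℝ} (hw : w ∈ W) :
    ℓ (extChartAt I c (bumpShift ℓ e α f y w)) =
      ℓ (extChartAt I c y) + f y * α (ℓ (extChartAt I c y)) w := by
  rw [bumpShift_of_mem_source hy, (extChartAt I c).right_inv (shift_mem_target hℓ he hf hα hy hw)]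
  simp [he]

variable {ι : Type*}

/-- Successive shifts by the bump functions of a covering. -/
noncomputable def coverShift (ℓ : E →L[ℝ] ℝ) (e : E) (α : ℝ → ℝ → ℝ)
    (fs : SmoothBumpCovering ι I M) (L : List ι) (y : M) (w : ℝ) : M :=
  L.foldr (fun i z => bumpShift ℓ e α (fs i) z w) y

variable {fs : SmoothBumpCovering ι I M} {L : List ι}

theorem coverShift_cons (i : ι) (y : M) (w : ℝ) :
    coverShift ℓ e α fs (i :: L) y w = bumpShift ℓ e α (fs i) (coverShift ℓ e α fs L y w) w :=
  rfl

theorem coverShift_of_amount_eq_zero {w : ℝ} (h : ∀ l, α l w = 0) (y : M) :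
    coverShift ℓ e α fs L y w = y := by
  induction L with
  | nil => rfl
  | cons i L ih => rw [coverShift_cons, ih, bumpShift_of_amount_eq_zero (h _)]

theorem coverShift_congr {w w' : ℝ} (h : ∀ l, α l w = α l w') (y : M) :
    coverShift ℓ e α fs L y w = coverShift ℓ e α fs L y w' := by
  induction L with
  | nil => rfl
  | cons i L ih => rw [coverShift_cons, coverShift_cons, ih, bumpShift, bumpShift, h]

variable [IsManifold I ∞ M]

theorem contMDiffOn_bumpShift [T2Space M] (hℓ : range I = {x | 0 ≤ ℓ x}) (he : ℓ e = 1)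
    {f : SmoothBumpFunction I c} (hf : ShiftsWithin ℓ e ε f) (hα : IsShiftAmount W ε α)
    (hαs : ContDiff ℝ ∞ fun q : ℝ × ℝ => α q.1 q.2) :
    ContMDiffOn (I.prod 𝓘(ℝ, ℝ)) I ∞ (fun q : M × ℝ => bumpShift ℓ e α f q.1 q.2)
      (univ ×ˢ W) := by
  rintro ⟨y, w⟩ ⟨-, hw⟩
  by_cases hy : y ∈ (extChartAt I c).source
  · have hnhds : (extChartAt I c).source ×ˢ W ∈ 𝓝[univ ×ˢ W] (y, w) := by
      rw [nhdsWithin_prod_eq, nhdsWithin_univ]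
      exact prod_mem_prod (extChartAt_source_mem_nhds' hy) self_mem_nhdsWithin
    refine ContMDiffWithinAt.mono_of_mem_nhdsWithin ?_ hnhds
    have h1 : ContMDiffOn (I.prod 𝓘(ℝ, ℝ)) 𝓘(ℝ, E) ∞ (fun q : M × ℝ => extChartAt I c q.1)
        ((extChartAt I c).source ×ˢ W) := by
      refine (contMDiffOn_extChartAt (n := ∞) (x := c)).comp contMDiff_fst.contMDiffOn ?_
      intro q hq
      rw [← extChartAt_source I]
      exact hq.1
    have h2 : ContMDiffOn (I.prod 𝓘(ℝ, ℝ)) 𝓘(ℝ, ℝ × ℝ) ∞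
        (fun q : M × ℝ => (ℓ (extChartAt I c q.1), q.2)) ((extChartAt I c).source ×ˢ W) :=
      (ℓ.contMDiff.comp_contMDiffOn h1).prodMk_space contMDiff_snd.contMDiffOn
    have h3 : ContMDiffOn (I.prod 𝓘(ℝ, ℝ)) 𝓘(ℝ, E) ∞
        (fun q : M × ℝ => extChartAt I c q.1 + (f q.1 * α (ℓ (extChartAt I c q.1)) q.2) • e)
        ((extChartAt I c).source ×ˢ W) := by
      have ha : ContMDiffOn (I.prod 𝓘(ℝ, ℝ)) 𝓘(ℝ, ℝ) ∞ (fun q : M × ℝ => f q.1)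
          ((extChartAt I c).source ×ˢ W) :=
        f.contMDiff.comp_contMDiffOn contMDiff_fst.contMDiffOn
      have hb : ContMDiffOn (I.prod 𝓘(ℝ, ℝ)) 𝓘(ℝ, ℝ) ∞
          (fun q : M × ℝ => α (ℓ (extChartAt I c q.1)) q.2) ((extChartAt I c).source ×ˢ W) :=
        hαs.contMDiff.comp_contMDiffOn h2
      exact h1.add ((ha.smul hb).smul contMDiffOn_const)
    have h4 := (contMDiffOn_extChartAt_symm (I := I) (n := ∞) c).comp h3
      (fun q hq => shift_mem_target hℓ he hf hα hq.1 hq.2)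
    exact (h4.congr fun q hq => bumpShift_of_mem_source hq.1) (y, w) ⟨hy, hw⟩
  · have hy' : y ∉ tsupport f := fun h => hy (f.tsupport_subset_extChartAt_source h)
    have h0 : ∀ᶠ q : M × ℝ in 𝓝 (y, w), f q.1 = 0 :=
      (continuous_fst.tendsto (y, w)).eventually (notMem_tsupport_iff_eventuallyEq.1 hy')
    have : ContMDiffAt (I.prod 𝓘(ℝ, ℝ)) I ∞ (fun q : M × ℝ => bumpShift ℓ e α f q.1 q.2) (y, w) :=
      contMDiffAt_fst.congr_of_eventuallyEq
        (h0.mono fun q hq => bumpShift_of_eq_zero hq)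
    exact this.contMDiffWithinAt

theorem bumpShift_of_mem_boundary (hℓ : range I = {x | 0 ≤ ℓ x}) (h0 : ℓ ≠ 0)
    {f : SmoothBumpFunction I c} {y : M} {w : ℝ}
    (hy : y ∈ I.boundary M) (hα0 : α 0 w = 0) : bumpShift ℓ e α f y w = y := by
  have : IsManifold I 1 M := .of_le (n := ∞) (by simp)
  by_cases hf : f y = 0
  · exact bumpShift_of_eq_zero hf
  · exact bumpShift_of_amount_eq_zero
      (by rwa [(mem_boundary_iff hℓ h0 (mem_source_of_ne_zero hf)).1 hy])

theorem contMDiffOn_coverShift [T2Space M] (hℓ : range I = {x | 0 ≤ ℓ x}) (he : ℓ e = 1)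
    (hf : ∀ i, ShiftsWithin ℓ e ε (fs i)) (hα : IsShiftAmount W ε α)
    (hαs : ContDiff ℝ ∞ fun q : ℝ × ℝ => α q.1 q.2) :
    ContMDiffOn (I.prod 𝓘(ℝ, ℝ)) I ∞ (fun q : M × ℝ => coverShift ℓ e α fs L q.1 q.2)
      (univ ×ˢ W) := by
  induction L with
  | nil => exact contMDiffOn_fst
  | cons i L ih =>
    exact (contMDiffOn_bumpShift hℓ he (hf i) hα hαs).comp (ih.prodMk contMDiffOn_snd)
      fun q hq => ⟨trivial, hq.2⟩

theorem coverShift_of_mem_boundary (hℓ : range I = {x | 0 ≤ ℓ x}) (h0 : ℓ ≠ 0) {y : M} {w : ℝ}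
    (hy : y ∈ I.boundary M) (hα0 : α 0 w = 0) : coverShift ℓ e α fs L y w = y := by
  induction L with
  | nil => rfl
  | cons i L ih => rw [coverShift_cons, ih, bumpShift_of_mem_boundary hℓ h0 hy hα0]

/-- The bump function that is `1` near `x` cancels the whole height when its turn comes. The shifts
before it fix `x`, so they keep points near `x`. The shifts after it fix the boundary, because the
amount vanishes at height `0`. -/
theorem eventually_coverShift_mem_boundary [T2Space M] (hℓ : range I = {x | 0 ≤ ℓ x})
    (he : ℓ e = 1)
    (hf : ∀ i, ShiftsWithin ℓ e ε (fs i)) (hα : IsShiftAmount W ε α)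
    (hαs : ContDiff ℝ ∞ fun q : ℝ × ℝ => α q.1 q.2) {w : ℝ} (hw : w ∈ W)
    (hαw : ∀ᶠ l in 𝓝 0, α l w = -l) {x : M} (hx : x ∈ I.boundary M)
    {i : ι} (hi : i ∈ L) (hix : fs i =ᶠ[𝓝 x] 1) :
    ∀ᶠ y in 𝓝 x, coverShift ℓ e α fs L y w ∈ I.boundary M := by
  have : IsManifold I 1 M := .of_le (n := ∞) (by simp)
  have h0 := ne_zero_of_mem_boundary hℓ hx
  have hα0 : α 0 w = 0 := by simpa using hαw.self_of_nhds
  induction L with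
  | nil => simp at hi
  | cons j L ih =>
    rcases List.mem_cons.1 hi with rfl | hi
    · have hc : Tendsto (fun y => coverShift ℓ e α fs L y w) (𝓝 x) (𝓝 x) := by
        have h1 := ((contMDiffOn_coverShift (L := L) hℓ he hf hα hαs).continuousOn (x, w)
          ⟨trivial, hw⟩)
        have h2 : Tendsto (fun y => (y, w)) (𝓝 x) (𝓝[univ ×ˢ W] (x, w)) :=
          tendsto_nhdsWithin_iff.2 ⟨by
            have : Continuous fun y : M => (y, w) := by fun_prop
            exact this.tendsto x, Eventually.of_forall fun y => ⟨trivial, hw⟩⟩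
        have h3 := h1.tendsto.comp h2
        simpa [Function.comp_def, coverShift_of_mem_boundary hℓ h0 hx hα0] using h3
      have hxs : x ∈ (extChartAt I (fs.c i)).source :=
        mem_source_of_ne_zero (f := fs i) (by rw [hix.self_of_nhds]; simp)
      have hh : Tendsto (fun y => ℓ (extChartAt I (fs.c i) y)) (𝓝 x) (𝓝 0) := by
        have := (ℓ.continuous.tendsto _).comp (continuousAt_extChartAt' hxs).tendsto
        rwa [(mem_boundary_iff hℓ h0 hxs).1 hx] at this
      filter_upwards [hc.eventually hix, hc.eventually (extChartAt_source_mem_nhds' hxs),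
        (hh.comp hc).eventually hαw] with y hy1 hy2 hy3
      rw [coverShift_cons, mem_boundary_iff hℓ h0 (bumpShift_mem_source hℓ he (hf i) hα hy2 hw),
        height_bumpShift hℓ he (hf i) hα hy2 hw, hy1]
      simp only [Function.comp] at hy3
      rw [hy3, Pi.one_apply]
      ring
    · filter_upwards [ih hi] with y hy
      rw [coverShift_cons, bumpShift_of_mem_boundary hℓ h0 hy hα0]
      exact hy

end Shift

/-! ### Boundary defining functions -/

section BoundaryDefining

variable {E : Type*} [NormedAddCommGroup E] [NormedSpace ℝ E] [FiniteDimensional ℝ E]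
  {H : Type*} [TopologicalSpace H]
  {I : ModelWithCorners ℝ E H} {M : Type*} [TopologicalSpace M] [ChartedSpace H M]
  [IsManifold I ∞ M] {ℓ : E →L[ℝ] ℝ}

/-- A smooth nonnegative function that vanishes exactly on the boundary, to first order. -/
structure IsBoundaryDefining (I : ModelWithCorners ℝ E H) (d : M → ℝ) : Prop where
  contMDiff : ContMDiff I 𝓘(ℝ, ℝ) ∞ d
  nonneg : ∀ x, 0 ≤ d x
  eq_zero_iff : ∀ x, d x = 0 ↔ x ∈ I.boundary M
  height_isBigO : ∀ ℓ : E →L[ℝ] ℝ, range I = {x | 0 ≤ ℓ x} → ∀ x ∈ I.boundary M, ∀ p,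
    x ∈ (extChartAt I p).source → (fun y => ℓ (extChartAt I p y)) =O[𝓝 x] d

theorem IsBoundaryDefining.isBigO_height {d : M → ℝ} (hd : IsBoundaryDefining I d)
    (hℓ : range I = {x | 0 ≤ ℓ x}) {p x : M} (hx : x ∈ I.boundary M)
    (hxp : x ∈ (extChartAt I p).source) : d =O[𝓝 x] fun y => ℓ (extChartAt I p y) := by
  have : IsManifold I 1 M := .of_le (n := ∞) (by simp)
  exact isBigO_height_of_eq_zero_on_boundary hℓ hx hxp ((hd.contMDiff x).of_le (by simp))
    (Eventually.of_forall fun y hy => (hd.eq_zero_iff y).2 hy)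

theorem height_isBigO_height {ℓ' : E →L[ℝ] ℝ} (hℓ : range I = {x | 0 ≤ ℓ x})
    (hℓ' : range I = {x | 0 ≤ ℓ' x}) {p q x : M} (hx : x ∈ I.boundary M)
    (hxp : x ∈ (extChartAt I p).source) (hxq : x ∈ (extChartAt I q).source) :
    (fun y => ℓ' (extChartAt I q y)) =O[𝓝 x] fun y => ℓ (extChartAt I p y) := by
  have : IsManifold I 1 M := .of_le (n := ∞) (by simp)
  refine isBigO_height_of_eq_zero_on_boundary hℓ hx hxp
    (ℓ'.contMDiff.contMDiffAt.comp x (contMDiffAt_extChartAt_of_mem_source hxq)) ?_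
  filter_upwards [extChartAt_source_mem_nhds' hxq] with y hy hyb
  exact (mem_boundary_iff hℓ' (ne_zero_of_mem_boundary hℓ' hx) hy).1 hyb

/-- A sum of chart heights weighted by bump functions. All terms are nonnegative, so near `x` the
sum dominates the height in a chart whose bump function is `1` there. Other charts cost only a
constant. -/
theorem exists_isBoundaryDefining (I : ModelWithCorners ℝ E H) [IsHalfSpaceModel I] (M : Type*)
    [TopologicalSpace M] [ChartedSpace H M] [IsManifold I ∞ M] [T2Space M] [CompactSpace M] :
    ∃ d : M → ℝ, IsBoundaryDefining I d := by
  have : IsManifold I 1 M := .of_le (n := ∞) (by simp)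
  obtain ⟨ℓ, hℓ⟩ := IsHalfSpaceModel.exists_range_eq (I := I)
  by_cases h0 : ℓ = 0
  · have hb : I.boundary M = ∅ := eq_empty_of_forall_notMem fun x hx =>
      ne_zero_of_mem_boundary hℓ hx h0
    refine ⟨fun _ => 1, contMDiff_const, fun _ => zero_le_one, fun x => by simp [hb], ?_⟩
    intro ℓ' _ x hx
    simp [hb] at hx
  obtain ⟨ι, fs, -⟩ := SmoothBumpCovering.exists_isSubordinate I (isClosed_univ (X := M))
    (U := fun _ => univ) (fun _ _ => univ_mem)
  have : Fintype ι := fs.fintype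
  set t : ι → M → ℝ := fun i y => fs i y * ℓ (extChartAt I (fs.c i) y) with ht
  have htn : ∀ i y, 0 ≤ t i y := fun i y => by
    by_cases hf : fs i y = 0
    · simp [ht, hf]
    · exact mul_nonneg (fs i).nonneg (apply_extChartAt_nonneg hℓ (mem_source_of_ne_zero hf))
  have hts : ∀ i, ContMDiff I 𝓘(ℝ, ℝ) ∞ (t i) := fun i =>
    (fs i).contMDiff_smul (ℓ.contMDiff.comp_contMDiffOn (contMDiffOn_extChartAt (n := ∞)))
  have hle : ∀ i y, t i y ≤ ∑ i, t i y := fun i y =>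
    Finset.single_le_sum (f := fun i => t i y) (fun i _ => htn i y) (Finset.mem_univ i)
  refine ⟨fun y => ∑ i, t i y, contMDiff_finsetSum fun i _ => hts i,
    fun y => Finset.sum_nonneg fun i _ => htn i y, fun x => ⟨fun hx => ?_, fun hx => ?_⟩, ?_⟩
  · obtain ⟨i, hi⟩ := fs.eventuallyEq_one' x (mem_univ x)
    have hi1 : fs i x = 1 := hi.self_of_nhds
    have h1 : t i x ≤ 0 := (hle i x).trans hx.le
    have hxs : x ∈ (extChartAt I (fs.c i)).source :=
      mem_source_of_ne_zero (f := fs i) (by rw [hi1]; simp)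
    rw [mem_boundary_iff hℓ h0 hxs]
    refine le_antisymm ?_ (apply_extChartAt_nonneg hℓ hxs)
    simpa only [ht, hi1, one_mul] using h1
  · refine Finset.sum_eq_zero fun i _ => ?_
    by_cases hf : fs i x = 0
    · simp [ht, hf]
    · simp only [ht]
      rw [(mem_boundary_iff hℓ h0 (mem_source_of_ne_zero hf)).1 hx, mul_zero]
  · intro ℓ' hℓ' x hx p hxp
    obtain ⟨i, hi⟩ := fs.eventuallyEq_one' x (mem_univ x)
    have hxs : x ∈ (extChartAt I (fs.c i)).source :=
      mem_source_of_ne_zero (f := fs i) (by rw [hi.self_of_nhds]; simp)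
    refine (height_isBigO_height hℓ hℓ' hx hxs hxp).trans (IsBigO.of_bound 1 ?_)
    filter_upwards [hi, extChartAt_source_mem_nhds' hxs] with y hy hys
    have h1 := hle i y
    have h2 := apply_extChartAt_nonneg hℓ hys
    simp only [ht, hy, Pi.one_apply, one_mul] at h1
    rw [Real.norm_of_nonneg h2, Real.norm_of_nonneg (h2.trans h1), one_mul]
    exact h1

end BoundaryDefining

/-! ### Squashing a neighbourhood of the boundary onto the boundary -/

section Squash

variable {E : Type*} [NormedAddCommGroup E] [NormedSpace ℝ E] [FiniteDimensional ℝ E]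
  {H : Type*} [TopologicalSpace H]

theorem exists_forall_shiftsWithin {I : ModelWithCorners ℝ E H} {M : Type*} [TopologicalSpace M]
    [ChartedSpace H M] [IsManifold I ∞ M] [T2Space M] [CompactSpace M] {ℓ : E →L[ℝ] ℝ}
    (hℓ : range I = {x | 0 ≤ ℓ x}) (e : E) {ι : Type*} [Finite ι]
    (fs : SmoothBumpCovering ι I M) : ∃ ε > 0, ∀ i, ShiftsWithin ℓ e ε (fs i) := by
  have := eventually_all.2 fun i => eventually_shiftsWithin (e := e) hℓ (fs i)
  obtain ⟨ε, h1, h2⟩ := (this.and self_mem_nhdsWithin).exists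
  exact ⟨ε, h2, h1⟩

/-- A family of smooth self-maps of `M`, equal to the identity for `w ≥ 2`, which for `w ≤ 1` is a
retraction of a neighbourhood of the boundary onto the boundary. -/
theorem exists_boundary_squash (I : ModelWithCorners ℝ E H) [IsHalfSpaceModel I] (M : Type*)
    [TopologicalSpace M] [ChartedSpace H M] [IsManifold I ∞ M] [T2Space M] [CompactSpace M] :
    ∃ K : M × ℝ → M, ContMDiff (I.prod 𝓘(ℝ, ℝ)) I ∞ K ∧
      (∀ x ∈ I.boundary M, ∀ w, K (x, w) = x) ∧ (∀ x w, 2 ≤ w → K (x, w) = x) ∧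
      (∀ x w, w ≤ 1 → K (x, w) = K (x, 0)) ∧
      ∀ x ∈ I.boundary M, ∀ᶠ y in 𝓝 x, K (y, 0) ∈ I.boundary M := by
  obtain ⟨ℓ, hℓ⟩ := IsHalfSpaceModel.exists_range_eq (I := I)
  by_cases h0 : ℓ = 0
  · refine ⟨Prod.fst, contMDiff_fst, fun _ _ _ => rfl, fun _ _ _ => rfl, fun _ _ _ => rfl,
      fun x hx => ?_⟩
    exact absurd h0 (ne_zero_of_mem_boundary hℓ hx)
  obtain ⟨e, he⟩ := surjective_of_ne_zero h0 1
  obtain ⟨ι, fs, -⟩ := SmoothBumpCovering.exists_isSubordinate I (isClosed_univ (X := M))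
    (U := fun _ => univ) (fun _ _ => univ_mem)
  have : Fintype ι := fs.fintype
  obtain ⟨ε, hε, hf⟩ := exists_forall_shiftsWithin hℓ e fs
  -- The first factor is `1` for `w ≤ 1` and `0` for `w ≥ 2`. The last one is `1` for `l ≤ ε / 2`
  -- and `0` for `l ≥ ε`: heights up to `ε / 2` are cancelled completely when `w ≤ 1`, and no shift
  -- exceeds `ε`.
  set α : ℝ → ℝ → ℝ := fun l w =>
    -(Real.smoothTransition (2 - w) * (l * Real.smoothTransition (2 - 2 / ε * l))) with hα
  have hαs : ContDiff ℝ ∞ fun q : ℝ × ℝ => α q.1 q.2 := by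
    have h := Real.smoothTransition.contDiff (n := ⊤)
    exact ((h.comp (contDiff_const.sub contDiff_snd)).mul (contDiff_fst.mul
      (h.comp (contDiff_const.sub (contDiff_const.mul contDiff_fst))))).neg
  have hαW : IsShiftAmount univ ε α := by
    intro l hl w _
    set a := Real.smoothTransition (2 - w)
    set b := Real.smoothTransition (2 - 2 / ε * l) with hb
    have ha0 : 0 ≤ a := Real.smoothTransition.nonneg _
    have ha1 : a ≤ 1 := Real.smoothTransition.le_one _
    have hb0 : 0 ≤ b := Real.smoothTransition.nonneg _
    have hb1 : b ≤ 1 := Real.smoothTransition.le_one _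
    have hlb : 0 ≤ l * b := mul_nonneg hl hb0
    have h1 : l * b ≤ l := mul_le_of_le_one_right hl hb1
    have h2 : l * b ≤ ε := by
      rcases le_total l ε with h | h
      · exact h1.trans h
      · have : b = 0 := Real.smoothTransition.zero_of_nonpos (by
          have : 2 / ε * ε ≤ 2 / ε * l := by gcongr
          rw [div_mul_cancel₀ _ hε.ne'] at this
          linarith)
        rw [this, mul_zero]
        exact hε.le
    have h3 : a * (l * b) ≤ l * b := mul_le_of_le_one_left hlb ha1
    refine ⟨neg_le_neg (h3.trans h1), ?_⟩
    rw [abs_neg, abs_of_nonneg (mul_nonneg ha0 hlb)]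
    exact h3.trans h2
  have hα0 : ∀ w, α 0 w = 0 := fun w => by simp [hα]
  refine ⟨fun q => coverShift ℓ e α fs Finset.univ.toList q.1 q.2, ?_, ?_, ?_, ?_, ?_⟩
  · rw [← contMDiffOn_univ, ← univ_prod_univ]
    exact contMDiffOn_coverShift hℓ he hf hαW hαs
  · exact fun x hx w => coverShift_of_mem_boundary hℓ h0 hx (hα0 w)
  · intro x w hw
    refine coverShift_of_amount_eq_zero (fun l => ?_) x
    simp [hα, Real.smoothTransition.zero_of_nonpos (show 2 - w ≤ 0 by linarith)]
  · intro x w hw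
    refine coverShift_congr (fun l => ?_) x
    simp [hα, Real.smoothTransition.one_of_one_le (show 1 ≤ 2 - w by linarith),
      Real.smoothTransition.one_of_one_le (show (1 : ℝ) ≤ 2 by norm_num)]
  · intro x hx
    obtain ⟨i, hi⟩ := fs.eventuallyEq_one' x (mem_univ x)
    refine eventually_coverShift_mem_boundary hℓ he hf hαW hαs (mem_univ 0) ?_ hx
      (Finset.mem_toList.2 (Finset.mem_univ i)) hi
    have h1 : ∀ᶠ l : ℝ in 𝓝 0, 2 / ε * l < 1 := by
      have h : Tendsto (fun l : ℝ => 2 / ε * l) (𝓝 0) (𝓝 (2 / ε * 0)) := tendsto_id.const_mul _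
      rw [mul_zero] at h
      exact h.eventually (gt_mem_nhds one_pos)
    filter_upwards [h1] with l hl
    simp [hα, Real.smoothTransition.one_of_one_le (show 1 ≤ 2 - 2 / ε * l by linarith),
      Real.smoothTransition.one_of_one_le (show (1 : ℝ) ≤ 2 by norm_num)]

end Squash

/-! ### Pushing the boundary into the interior -/

section Push

variable {E : Type*} [NormedAddCommGroup E] [NormedSpace ℝ E] [FiniteDimensional ℝ E]
  {H : Type*} [TopologicalSpace H] {I : ModelWithCorners ℝ E H} {M : Type*}
  [TopologicalSpace M] [ChartedSpace H M] [IsManifold I ∞ M] {ℓ : E →L[ℝ] ℝ} {e : E} {ε : ℝ}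
  {ι : Type*} {fs : SmoothBumpCovering ι I M} {L : List ι}

theorem isShiftAmount_push (ε : ℝ) : IsShiftAmount (Icc 0 ε) ε fun _ s => s := by
  intro h hh s hs
  refine ⟨by linarith [hs.1], ?_⟩
  rw [abs_of_nonneg hs.1]
  exact hs.2

theorem bumpShift_push_notMem_boundary (hℓ : range I = {x | 0 ≤ ℓ x}) (he : ℓ e = 1) {c : M}
    {f : SmoothBumpFunction I c} (hf : ShiftsWithin ℓ e ε f) {y : M} {s : ℝ}
    (hs : s ∈ Ioc 0 ε) (hy : y ∉ I.boundary M ∨ f y ≠ 0) :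
    bumpShift ℓ e (fun _ s => s) f y s ∉ I.boundary M := by
  have : IsManifold I 1 M := .of_le (n := ∞) (by simp)
  have h0 : ℓ ≠ 0 := by rintro rfl; simp at he
  have hs' : s ∈ Icc 0 ε := Ioc_subset_Icc_self hs
  by_cases hfy : f y = 0
  · rw [bumpShift_of_eq_zero hfy]
    exact hy.resolve_right (not_not.2 hfy)
  · have hys := mem_source_of_ne_zero hfy
    rw [mem_boundary_iff hℓ h0 (bumpShift_mem_source hℓ he hf (isShiftAmount_push ε) hys hs'),
      height_bumpShift hℓ he hf (isShiftAmount_push ε) hys hs']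
    have h1 := apply_extChartAt_nonneg hℓ hys
    have h2 : 0 < f y := lt_of_le_of_ne f.nonneg (Ne.symm hfy)
    have h3 := mul_pos h2 hs.1
    linarith

theorem coverShift_push_notMem_boundary (hℓ : range I = {x | 0 ≤ ℓ x}) (he : ℓ e = 1)
    (hf : ∀ i, ShiftsWithin ℓ e ε (fs i)) {y : M} {s : ℝ} (hs : s ∈ Ioc 0 ε) {i : ι}
    (hi : i ∈ L) (hiy : fs i y ≠ 0) :
    coverShift ℓ e (fun _ s => s) fs L y s ∉ I.boundary M := by
  -- Heights never decrease, so a point off the boundary stays off it. Until a bump function nonzero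
  -- at `y` is met, `y` has not moved, and the first such bump function lifts it off.
  have key : coverShift ℓ e (fun _ s => s) fs L y s ∉ I.boundary M ∨
      (coverShift ℓ e (fun _ s => s) fs L y s = y ∧ ∀ i ∈ L, fs i y = 0) := by
    clear hi
    induction L with
    | nil => exact Or.inr ⟨rfl, by simp⟩
    | cons j L ih =>
      rw [coverShift_cons]
      rcases ih with h | ⟨h, h'⟩
      · exact Or.inl (bumpShift_push_notMem_boundary hℓ he (hf j) hs (Or.inl h))
      · rw [h]
        by_cases hj : fs j y = 0
        · refine Or.inr ⟨bumpShift_of_eq_zero hj, ?_⟩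
          intro i hi
          rcases List.mem_cons.1 hi with rfl | hi
          exacts [hj, h' i hi]
        · exact Or.inl (bumpShift_push_notMem_boundary hℓ he (hf j) hs (Or.inr hj))
  exact key.resolve_right fun h => hiy (h.2 i hi)

/-- A bump function equal to `1` near `x` raises the height in its own chart by exactly `s`. Later
shifts do not lower the heights in their own charts, and heights in different charts are compared
through `d` at the cost of constants. -/
theorem isBigO_coverShift_push [T2Space M] (hℓ : range I = {x | 0 ≤ ℓ x}) (he : ℓ e = 1)
    (hε : 0 < ε) (hf : ∀ i, ShiftsWithin ℓ e ε (fs i)) {d : M → ℝ} (hd : IsBoundaryDefining I d)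
    {x : M} (hx : x ∈ I.boundary M) {i : ι} (hi : i ∈ L) (hix : fs i =ᶠ[𝓝 x] 1) :
    (fun q : M × ℝ => q.2) =O[𝓝 x ×ˢ 𝓝[≥] 0]
      fun q => d (coverShift ℓ e (fun _ s => s) fs L q.1 q.2) := by
  have : IsManifold I 1 M := .of_le (n := ∞) (by simp)
  have h0 := ne_zero_of_mem_boundary hℓ hx
  have hs : ∀ᶠ q : M × ℝ in 𝓝 x ×ˢ 𝓝[≥] 0, q.2 ∈ Icc 0 ε :=
    tendsto_snd.eventually (Icc_mem_nhdsGE hε)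
  have htend : ∀ L : List ι, Tendsto (fun q : M × ℝ => coverShift ℓ e (fun _ s => s) fs L q.1 q.2)
      (𝓝 x ×ˢ 𝓝[≥] 0) (𝓝 x) := by
    intro L
    have h1 := (contMDiffOn_coverShift (L := L) hℓ he hf (isShiftAmount_push ε)
      contDiff_snd).continuousOn (x, 0) ⟨trivial, by simp [hε.le]⟩
    have h2 := h1.tendsto
    rw [nhdsWithin_prod_eq, nhdsWithin_univ, nhdsWithin_Icc_eq_nhdsGE hε] at h2
    simpa [coverShift_of_mem_boundary hℓ h0 hx] using h2
  induction L with
  | nil => simp at hi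
  | cons j L ih =>
    have hT := htend L
    have hT' := htend (j :: L)
    by_cases hxj : x ∈ (extChartAt I (fs.c j)).source
    · have hB := (hd.height_isBigO ℓ hℓ x hx _ hxj).comp_tendsto hT'
      refine IsBigO.trans ?_ hB
      rcases List.mem_cons.1 hi with rfl | hi
      · refine IsBigO.of_bound 1 ?_
        filter_upwards [hs, hT.eventually hix, hT.eventually (extChartAt_source_mem_nhds' hxj)]
          with q hq hq1 hq2
        have h3 := apply_extChartAt_nonneg hℓ hq2
        simp only [Function.comp]
        rw [coverShift_cons, height_bumpShift hℓ he (hf i) (isShiftAmount_push ε) hq2 hq, hq1,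
          Real.norm_of_nonneg hq.1, Pi.one_apply, one_mul, one_mul]
        exact le_trans (by linarith) (le_abs_self _)
      · have hA := (hd.isBigO_height hℓ hx hxj).comp_tendsto hT
        refine (ih hi).trans (hA.trans (IsBigO.of_bound 1 ?_))
        filter_upwards [hs, hT.eventually (extChartAt_source_mem_nhds' hxj)] with q hq hq2
        have h3 := apply_extChartAt_nonneg hℓ hq2
        have h4 := mul_nonneg ((fs j).nonneg (x := coverShift ℓ e (fun _ s => s) fs L q.1 q.2)) hq.1
        simp only [Function.comp]
        rw [coverShift_cons, height_bumpShift hℓ he (hf j) (isShiftAmount_push ε) hq2 hq,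
          Real.norm_of_nonneg h3, one_mul]
        exact le_trans (by linarith) (le_abs_self _)
    · have hi : i ∈ L := by
        rcases List.mem_cons.1 hi with rfl | hi
        · exact absurd (mem_source_of_ne_zero (f := fs i) (by rw [hix.self_of_nhds]; simp)) hxj
        · exact hi
      have hj : ∀ᶠ y in 𝓝 x, fs j y = 0 := notMem_tsupport_iff_eventuallyEq.1
        fun h => hxj ((fs j).tsupport_subset_extChartAt_source h)
      refine (ih hi).congr' EventuallyEq.rfl ?_
      filter_upwards [hT.eventually hj] with q hq
      rw [coverShift_cons, bumpShift_of_eq_zero hq]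

/-- Moving into the interior from the boundary, at positive speed. -/
theorem exists_boundary_push (I : ModelWithCorners ℝ E H) [IsHalfSpaceModel I] {M : Type*}
    [TopologicalSpace M] [ChartedSpace H M] [IsManifold I ∞ M] [T2Space M] [CompactSpace M]
    {d : M → ℝ} (hd : IsBoundaryDefining I d) :
    ∃ ε > 0, ∃ Φ : M × ℝ → M,
      ContMDiffOn (I.prod 𝓘(ℝ, ℝ)) I ∞ Φ (univ ×ˢ Icc 0 ε) ∧ (∀ y, Φ (y, 0) = y) ∧
      (∀ y ∈ I.boundary M, ∀ s ∈ Ioc 0 ε, Φ (y, s) ∉ I.boundary M) ∧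
      ∀ y ∈ I.boundary M, (fun q : M × ℝ => q.2) =O[𝓝 y ×ˢ 𝓝[≥] 0] (d ∘ Φ) := by
  obtain ⟨ℓ, hℓ⟩ := IsHalfSpaceModel.exists_range_eq (I := I)
  by_cases h0 : ℓ = 0
  · exact ⟨1, one_pos, Prod.fst, contMDiffOn_fst, fun _ => rfl,
      fun x hx => absurd h0 (ne_zero_of_mem_boundary hℓ hx),
      fun x hx => absurd h0 (ne_zero_of_mem_boundary hℓ hx)⟩
  obtain ⟨e, he⟩ := surjective_of_ne_zero h0 1
  obtain ⟨ι, fs, -⟩ := SmoothBumpCovering.exists_isSubordinate I (isClosed_univ (X := M))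
    (U := fun _ => univ) (fun _ _ => univ_mem)
  have : Fintype ι := fs.fintype
  obtain ⟨ε, hε, hf⟩ := exists_forall_shiftsWithin hℓ e fs
  refine ⟨ε, hε, fun q => coverShift ℓ e (fun _ s => s) fs Finset.univ.toList q.1 q.2,
    contMDiffOn_coverShift hℓ he hf (isShiftAmount_push ε) contDiff_snd,
    fun y => coverShift_of_amount_eq_zero (fun _ => rfl) y, fun y hy s hs => ?_, fun y hy => ?_⟩
  · obtain ⟨i, hi⟩ := fs.eventuallyEq_one' y (mem_univ y)
    exact coverShift_push_notMem_boundary hℓ he hf hs (Finset.mem_toList.2 (Finset.mem_univ i))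
      (by rw [hi.self_of_nhds]; simp)
  · obtain ⟨i, hi⟩ := fs.eventuallyEq_one' y (mem_univ y)
    exact isBigO_coverShift_push hℓ he hε hf hd hy (Finset.mem_toList.2 (Finset.mem_univ i)) hi

end Push

/-! ### Spreading open conditions from a zero set by compactness -/

section Compactness

variable {X Y : Type*} [TopologicalSpace X] [TopologicalSpace Y]

/-- The points where `P` does not hold locally form a compact set, on which `ρ` attains a positive
minimum. -/
theorem exists_pos_forall_lt_of_compactSpace [CompactSpace X] {ρ : X → ℝ} (hρ : Continuous ρ)
    (hρ0 : ∀ x, 0 ≤ ρ x) {P : X → Prop} (hP : ∀ x, ρ x = 0 → ∀ᶠ y in 𝓝 x, P y) :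
    ∃ η > 0, ∀ y, ρ y < η → P y := by
  have hU : IsOpen {x | ∀ᶠ y in 𝓝 x, P y} := isOpen_setOfPred_eventually_nhds
  rcases ({x | ∀ᶠ y in 𝓝 x, P y}ᶜ).eq_empty_or_nonempty with h | h
  · rw [compl_empty_iff] at h
    exact ⟨1, one_pos, fun y _ => (h.ge (mem_univ y) : ∀ᶠ z in 𝓝 y, P z).self_of_nhds⟩
  · obtain ⟨m, hm, hmin⟩ := hU.isClosed_compl.isCompact.exists_isMinOn h hρ.continuousOn
    refine ⟨ρ m, lt_of_le_of_ne (hρ0 m) fun h0 => hm (hP m h0.symm), fun y hy => ?_⟩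
    by_contra hPy
    exact absurd (hmin (a := y) fun h' => hPy (Eventually.self_of_nhds h')) (not_le.2 hy)

theorem exists_pos_injOn_of_compactSpace [CompactSpace X] [T2Space Y] {ρ : X → ℝ}
    (hρ : Continuous ρ) (hρ0 : ∀ x, 0 ≤ ρ x) {f : X → Y} (hf : Continuous f)
    (hinj : InjOn f {x | ρ x = 0}) (hloc : ∀ x, ρ x = 0 → ∃ u ∈ 𝓝 x, InjOn f u) :
    ∃ η > 0, InjOn f {x | ρ x < η} := by
  obtain ⟨t, ht, htf⟩ := hinj.exists_mem_nhdsSet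
    ((isClosed_singleton (x := (0 : ℝ))).preimage hρ).isCompact
    (fun x _ => hf.continuousAt) hloc
  obtain ⟨η, hη, h⟩ := exists_pos_forall_lt_of_compactSpace hρ hρ0 (P := fun y => y ∈ t)
    fun x hx => mem_nhdsSet_iff_forall.1 ht x hx
  exact ⟨η, hη, htf.mono h⟩

theorem exists_pos_forall_lt_of_isCompact {C : Set X} (hC : IsCompact C) {ρ : X → ℝ}
    (hρ : Continuous ρ) (hρ0 : ∀ x ∈ C, 0 ≤ ρ x) {P : X → Prop}
    (hP : ∀ x ∈ C, ρ x = 0 → ∀ᶠ y in 𝓝[C] x, P y) : ∃ η > 0, ∀ y ∈ C, ρ y < η → P y := by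
  have := isCompact_iff_compactSpace.1 hC
  obtain ⟨η, hη, h⟩ := exists_pos_forall_lt_of_compactSpace (X := C) (ρ := fun x => ρ x)
    (hρ.comp continuous_subtype_val) (fun x => hρ0 x x.2) (P := fun x => P x)
    fun x hx => (eventually_nhds_subtype_iff C x P).2 (hP x x.2 hx)
  exact ⟨η, hη, fun y hy => h ⟨y, hy⟩⟩

theorem exists_pos_injOn_of_isCompact [T2Space Y] {C : Set X} (hC : IsCompact C) {ρ : X → ℝ}
    (hρ : Continuous ρ) (hρ0 : ∀ x ∈ C, 0 ≤ ρ x) {f : X → Y} (hf : ContinuousOn f C)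
    (hinj : InjOn f (C ∩ {x | ρ x = 0})) (hloc : ∀ x ∈ C, ρ x = 0 → ∃ u ∈ 𝓝[C] x, InjOn f u) :
    ∃ η > 0, InjOn f (C ∩ {x | ρ x < η}) := by
  have := isCompact_iff_compactSpace.1 hC
  obtain ⟨η, hη, h⟩ := exists_pos_injOn_of_compactSpace (X := C) (ρ := fun x => ρ x)
    (hρ.comp continuous_subtype_val) (fun x => hρ0 x x.2) (f := fun x => f x) hf.domRestrict
    (fun x hx y hy hxy => Subtype.ext (hinj ⟨x.2, hx⟩ ⟨y.2, hy⟩ hxy)) (by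
      intro x hx
      obtain ⟨u, hu, hfu⟩ := hloc x x.2 hx
      refine ⟨Subtype.val ⁻¹' u, ?_, fun a ha b hb hab => Subtype.ext (hfu ha hb hab)⟩
      exact (eventually_nhds_subtype_iff C x (· ∈ u)).2 hu)
  refine ⟨η, hη, fun x hx y hy hxy => ?_⟩
  exact congrArg Subtype.val
    (h (show (⟨x, hx.1⟩ : C) ∈ _ from hx.2) (show (⟨y, hy.1⟩ : C) ∈ _ from hy.2) hxy)

/-- The bound holds on a whole square `t ×ˢ t`, and `t` is also a neighbourhood within `S` of every
nearby point. Being expanding is thus an open condition. -/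
theorem IncrBigO.eventually_nhdsWithin {E F : Type*} [NormedAddCommGroup E]
    [NormedAddCommGroup F] {S : Set X} {x : X} {a : X → E} {b : X → F}
    (h : IncrBigO (𝓝[S] x) a b) : ∀ᶠ y in 𝓝[S] x, IncrBigO (𝓝[S] y) a b := by
  obtain ⟨C, hC⟩ := h.bound
  obtain ⟨t, ht, htC⟩ := mem_prod_same_iff.1 hC
  filter_upwards [eventually_eventually_nhdsWithin.2 ht] with y hy
  exact IsBigO.of_bound C (mem_of_superset (prod_mem_prod hy hy) htC)

end Compactness

/-! ### Lifts through immersions, changes of chart and charts of products -/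

section Lift

variable {E : Type*} [NormedAddCommGroup E] [NormedSpace ℝ E] {H : Type*} [TopologicalSpace H]
  {I : ModelWithCorners ℝ E H} {M : Type*} [TopologicalSpace M] [ChartedSpace H M]
  {E' : Type*} [NormedAddCommGroup E'] [NormedSpace ℝ E'] {H' : Type*} [TopologicalSpace H']
  {J : ModelWithCorners ℝ E' H'} {N : Type*} [TopologicalSpace N] [ChartedSpace H' N]
  {E'' : Type*} [NormedAddCommGroup E''] [NormedSpace ℝ E''] {H'' : Type*} [TopologicalSpace H'']
  {K : ModelWithCorners ℝ E'' H''} {X : Type*} [TopologicalSpace X] [ChartedSpace H'' X]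

/-- A continuous lift of a smooth map through an immersion is smooth. -/
theorem ContMDiffAt.of_comp_immersion [FiniteDimensional ℝ E] [FiniteDimensional ℝ E']
    [J.Boundaryless] [IsManifold I ∞ M] [IsManifold J ∞ N] {j : N → M} (hj : ContMDiff J I ∞ j)
    {f : X → N} {x : X} (hinj : Function.Injective (mfderiv J I j (f x)))
    (hf : ContinuousAt f x) (hjf : ContMDiffAt K I ∞ (j ∘ f) x) : ContMDiffAt K J ∞ f x := by
  set b := f x with hb
  set D : E' →L[ℝ] E := mfderiv J I j b with hD
  have hd : HasFDerivWithinAt (writtenInExtChartAt J I b j) D (range J) (extChartAt J b b) :=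
    ((hj b).mdifferentiableAt (by simp)).hasMFDerivAt.2
  -- Followed by a linear left inverse of its differential, `j` becomes a local diffeomorphism `g`
  -- in charts. Then `f` is recovered by applying the local inverse of `g` to the smooth map `L ∘ j
  -- ∘ f`.
  obtain ⟨L₀, hL₀⟩ := LinearMap.exists_leftInverse_of_injective (D : E' →ₗ[ℝ] E)
    (LinearMap.ker_eq_bot.2 hinj)
  set L : E →L[ℝ] E' := LinearMap.toContinuousLinearMap L₀
  set g : E' → E' := fun z => L (writtenInExtChartAt J I b j z) with hg
  have hgs : ContDiffAt ℝ ∞ g (extChartAt J b b) := by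
    have h1 := (contMDiffAt_iff.1 (hj b)).2
    rw [ModelWithCorners.range_eq_univ, contDiffWithinAt_univ] at h1
    exact L.contDiff.contDiffAt.comp _ h1
  have hgd : HasFDerivAt g ((ContinuousLinearEquiv.refl ℝ E' : E' ≃L[ℝ] E') : E' →L[ℝ] E')
      (extChartAt J b b) := by
    rw [ModelWithCorners.range_eq_univ, hasFDerivWithinAt_univ] at hd
    have h : ((ContinuousLinearEquiv.refl ℝ E' : E' ≃L[ℝ] E') : E' →L[ℝ] E') = L.comp D :=
      ContinuousLinearMap.ext fun v => (LinearMap.congr_fun hL₀ v).symm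
    rw [h]
    exact L.hasFDerivAt.comp _ hd
  have hstrict := hgs.hasStrictFDerivAt' hgd (by simp)
  have hleft := hstrict.eventually_left_inverse
  have hinv := hgs.to_localInverse hgd (by simp)
  rw [contMDiffAt_iff_target]
  refine ⟨hf, ?_⟩
  have h2 : ContMDiffAt K 𝓘(ℝ, E') ∞
      (fun y => L (extChartAt I (j b) (j (f y)))) x :=
    L.contMDiff.contMDiffAt.comp x ((contMDiffAt_iff_target.1 hjf).2)
  have hval : L (extChartAt I (j b) (j (f x))) = g (extChartAt J b b) := by
    simp [hg, writtenInExtChartAt, ← hb]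
  have h3 := ContMDiffAt.comp x (g := hgs.localInverse hgd (by simp))
    (by rw [hval]; exact hinv.contMDiffAt) h2
  refine h3.congr_of_eventuallyEq ?_
  have hc : Tendsto (fun y => extChartAt J b (f y)) (𝓝 x) (𝓝 (extChartAt J b b)) :=
    (continuousAt_extChartAt b).tendsto.comp hf
  filter_upwards [hc.eventually hleft, hf (extChartAt_source_mem_nhds (I := J) b)] with y hy hys
  have hgy : L (extChartAt I (j b) (j (f y))) = g (extChartAt J b (f y)) := by
    simp only [hg, writtenInExtChartAt, Function.comp]
    rw [(extChartAt J b).left_inv hys]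
  simp only [Function.comp]
  rw [hgy]
  exact hy.symm

end Lift

section ChartChange

variable {E : Type*} [NormedAddCommGroup E] [NormedSpace ℝ E] {H : Type*} [TopologicalSpace H]
  {I : ModelWithCorners ℝ E H} {M : Type*} [TopologicalSpace M] [ChartedSpace H M]
  [IsManifold I ∞ M]

theorem extChartAt_incrBigO_extChartAt {p q x : M} (hp : x ∈ (extChartAt I p).source)
    (hq : x ∈ (extChartAt I q).source) :
    IncrBigO (𝓝 x) (extChartAt I p) (extChartAt I q) := by
  have : IsManifold I 1 M := .of_le (n := ∞) (by simp)
  have := incrBigO_extChartAt_of_contMDiffWithinAt (S := univ) hq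
    (by rw [preimage_univ, univ_inter]; exact I.convex_range)
    (contMDiffAt_extChartAt_of_mem_source (n := 1) hp).contMDiffWithinAt
  rwa [nhdsWithin_univ] at this

end ChartChange

section ProductCharts

variable {E : Type*} [NormedAddCommGroup E] [NormedSpace ℝ E] {H : Type*} [TopologicalSpace H]
  {I : ModelWithCorners ℝ E H} {M : Type*} [TopologicalSpace M] [ChartedSpace H M]
  {F : Type*} [NormedAddCommGroup F] [NormedSpace ℝ F]

theorem eventually_nonneg_add_smul {ℓ : E →L[ℝ] ℝ} {z v : E} (hz : ℓ z = 0) (hv : 0 ≤ ℓ v) :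
    ∀ᶠ t : ℝ in 𝓝[≥] 0, 0 ≤ ℓ (z + t • v) := by
  filter_upwards [self_mem_nhdsWithin] with t ht
  rw [map_add, map_smul, hz, zero_add]
  exact mul_nonneg ht hv

theorem extChartAt_prod_space (p : M) (w : F) :
    extChartAt (I.prod 𝓘(ℝ, F)) (p, w) = (extChartAt I p).prod (PartialEquiv.refl F) := by
  rw [extChartAt_prod, extChartAt_model_space_eq_id]

theorem extChartAt_prod_space_symm_preimage (p : M) (w : F) (T : Set F) :
    (extChartAt (I.prod 𝓘(ℝ, F)) (p, w)).symm ⁻¹' (univ ×ˢ T) ∩ range (I.prod 𝓘(ℝ, F)) =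
      range I ×ˢ T := by
  rw [extChartAt_prod_space, modelWithCorners_prod_coe, range_prodMap]
  ext q
  simp [and_comm]

end ProductCharts

/-! ### The squash together with the distance to the boundary is expanding -/

section SquashExpanding

variable {E : Type*} [NormedAddCommGroup E] [NormedSpace ℝ E] [FiniteDimensional ℝ E]
  {H : Type*} [TopologicalSpace H]
  {I : ModelWithCorners ℝ E H} {M : Type*} [TopologicalSpace M] [ChartedSpace H M]
  [IsManifold I ∞ M] {d : M → ℝ} {K : M × ℝ → M}

/-- A tangent vector killed by the differential has zero `w`-component by the last entry. Its normal
component vanishes because `d` grows at least linearly with the height. What remains is tangent to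
the boundary, where the squash is the identity. -/
theorem squash_incrBigO [IsHalfSpaceModel I] (hd : IsBoundaryDefining I d)
    (hK : ContMDiff (I.prod 𝓘(ℝ, ℝ)) I ∞ K) (hKb : ∀ x ∈ I.boundary M, ∀ w, K (x, w) = x)
    {x : M} (hx : x ∈ I.boundary M) (w : ℝ) :
    IncrBigO (𝓝 (x, w)) (fun q : M × ℝ => (extChartAt I x q.1, q.2))
      (fun q : M × ℝ => (extChartAt I x (K q), d q.1, q.2)) := by
  have : IsManifold I 1 M := .of_le (n := ∞) (by simp)
  obtain ⟨ℓ, hℓ⟩ := IsHalfSpaceModel.exists_range_eq (I := I)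
  have h0 := ne_zero_of_mem_boundary hℓ hx
  have hxs := mem_extChartAt_source (I := I) x
  set φ := extChartAt I x with hφ
  set z := φ x with hz
  have hz0 : ℓ z = 0 := (mem_boundary_iff hℓ h0 hxs).1 hx
  set a : M × ℝ → E × ℝ × ℝ := fun q => (φ (K q), d q.1, q.2) with ha
  have hKx : K (x, w) = x := hKb x hx w
  have has : ContMDiffAt (I.prod 𝓘(ℝ, ℝ)) 𝓘(ℝ, E × ℝ × ℝ) 1 a (x, w) := by
    have h1 : ContMDiffAt (I.prod 𝓘(ℝ, ℝ)) 𝓘(ℝ, E) 1 (fun q => φ (K q)) (x, w) :=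
      ContMDiffAt.comp (x, w) (g := φ) (f := K) (by rw [hKx]; exact contMDiffAt_extChartAt)
        ((hK (x, w)).of_le (by simp))
    have h2 : ContMDiffAt (I.prod 𝓘(ℝ, ℝ)) 𝓘(ℝ, ℝ) 1 (fun q : M × ℝ => d q.1) (x, w) :=
      ((hd.contMDiff.comp contMDiff_fst) (x, w)).of_le (by simp)
    exact h1.prodMk_space (h2.prodMk_space contMDiffAt_snd)
  have key := extChartAt_incrBigO_of_contMDiffWithinAt (I := I.prod 𝓘(ℝ, ℝ)) (S := univ)
    (p := (x, w)) (x := (x, w)) (a := a) (mem_extChartAt_source _) trivial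
    (by rw [← univ_prod_univ, extChartAt_prod_space_symm_preimage]; exact I.convex_range.prod convex_univ)
    has.contMDiffWithinAt ?_
  · rw [nhdsWithin_univ, extChartAt_prod_space] at key
    exact key
  have hsymm : ∀ q : E × ℝ, (extChartAt (I.prod 𝓘(ℝ, ℝ)) (x, w)).symm q = (φ.symm q.1, q.2) :=
    fun q => by rw [extChartAt_prod_space]; rfl
  have hbase : extChartAt (I.prod 𝓘(ℝ, ℝ)) (x, w) (x, w) = (z, w) := by
    rw [extChartAt_prod_space]; rfl
  rw [← univ_prod_univ, extChartAt_prod_space_symm_preimage, hbase]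
  set g : E × ℝ → E × ℝ × ℝ := a ∘ (extChartAt (I.prod 𝓘(ℝ, ℝ)) (x, w)).symm with hg
  have hgq : ∀ q, g q = (φ (K (φ.symm q.1, q.2)), d (φ.symm q.1), q.2) := fun q => by
    simp only [hg, Function.comp, hsymm, ha]
  intro g' hg'
  have hcone : ∀ v : E, ∀ ξ : ℝ, 0 ≤ ℓ v →
      ∀ᶠ t : ℝ in 𝓝[≥] 0, (z, w) + t • (v, ξ) ∈ range I ×ˢ (univ : Set ℝ) := by
    intro v ξ hv
    filter_upwards [eventually_nonneg_add_smul hz0 hv] with t ht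
    refine ⟨?_, trivial⟩
    rw [hℓ]
    exact ht
  have hgz : g (z, w) = (z, 0, w) := by
    rw [hgq]
    simp only [hz]
    rw [φ.left_inv hxs, hKx, (hd.eq_zero_iff x).2 hx]
  -- Only inward vectors can be tested along rays in the half-space; the others are covered by a
  -- change of sign.
  suffices h : ∀ v : E, ∀ ξ : ℝ, 0 ≤ ℓ v → g' (v, ξ) = 0 → v = 0 ∧ ξ = 0 by
    rintro ⟨v, ξ⟩ hv
    rcases le_total 0 (ℓ v) with hl | hl
    · obtain ⟨rfl, rfl⟩ := h v ξ hl hv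
      rfl
    · have := h (-v) (-ξ) (by rw [map_neg]; linarith)
        (by rw [show ((-v, -ξ) : E × ℝ) = -(v, ξ) from rfl, map_neg, hv, neg_zero])
      simp only [neg_eq_zero] at this
      rw [this.1, this.2]
      rfl
  intro v ξ hv hgv
  have hξ : ξ = 0 := by
    have h3 := HasFDerivWithinAt.apply_eq_of_eventuallyEq hg'.snd.snd (v := (v, ξ)) (u := ξ)
      (hcone v ξ hv) (Eventually.of_forall fun t => by simp [hgq])
    rw [← h3]
    simp [hgv]
  subst hξ
  have hlim := (tendsto_add_smul_nhdsWithin (z := z) (v := v) (C := range I) (by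
    filter_upwards [eventually_nonneg_add_smul hz0 hv] with t ht
    rw [hℓ]
    exact ht))
  have htgt : ∀ᶠ t : ℝ in 𝓝[≥] 0, z + t • v ∈ φ.target :=
    hlim (extChartAt_target_mem_nhdsWithin x)
  have hℓv : ℓ v = 0 := by
    obtain ⟨C, hC, hB⟩ := (hd.height_isBigO ℓ hℓ x hx x hxs).exists_pos
    have hsx : Tendsto (fun t : ℝ => φ.symm (z + t • v)) (𝓝[≥] 0) (𝓝 x) :=
      Tendsto.comp (map_extChartAt_symm_nhdsWithin_range (I := I) x).le hlim
    have hB' := hsx.eventually hB.bound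
    have h2 := HasFDerivWithinAt.apply_nonneg hg'.snd.fst (v := (v, 0)) (a := ℓ v / C)
      (hcone v 0 hv) (by rw [hgz]) (by
        filter_upwards [htgt, hB'] with t ht ht'
        rw [φ.right_inv ht, map_add, map_smul, hz0, zero_add, smul_eq_mul,
          Real.norm_of_nonneg (hd.nonneg _)] at ht'
        rw [hgq, ← mul_div_assoc, div_le_iff₀' hC]
        exact (le_abs_self _).trans ht')
    have h4 : ℓ v / C ≤ 0 := by simpa [hgv] using h2
    have h5 := div_nonneg hv hC.le
    have h6 : ℓ v / C = 0 := le_antisymm h4 h5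
    exact (div_eq_zero_iff.1 h6).resolve_right hC.ne'
  refine ⟨?_, rfl⟩
  have h1 := HasFDerivWithinAt.apply_eq_of_eventuallyEq hg'.fst (v := (v, 0)) (u := v)
    (hcone v 0 hv) (by
      filter_upwards [htgt] with t ht
      have hb : φ.symm (z + t • v) ∈ I.boundary M := by
        rw [mem_boundary_iff hℓ h0 (φ.map_target ht)]
        change ℓ (φ _) = 0
        rw [φ.right_inv ht, map_add, map_smul, hz0, hℓv]
        simp
      rw [hgz, hgq]
      simp only [Prod.fst_add, Prod.smul_fst]
      rw [hKb _ hb, φ.right_inv ht])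
  rw [← h1]
  simp [hgv]

end SquashExpanding

section ChangeOfCharts

variable {E : Type*} [NormedAddCommGroup E] [NormedSpace ℝ E] {H : Type*} [TopologicalSpace H]
  {I : ModelWithCorners ℝ E H} {M : Type*} [TopologicalSpace M] [ChartedSpace H M]
  [IsManifold I ∞ M] {X F : Type*} [NormedAddCommGroup F] {l : Filter X} {a : X → F} {f : X → M}
  {p q y : M}

theorem IncrBigO.change_chart_right (h : IncrBigO l a (extChartAt I p ∘ f))
    (hf : Tendsto f l (𝓝 y)) (hp : y ∈ (extChartAt I p).source)
    (hq : y ∈ (extChartAt I q).source) : IncrBigO l a (extChartAt I q ∘ f) :=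
  h.trans ((extChartAt_incrBigO_extChartAt hp hq).comp_tendsto hf)

theorem IncrBigO.prod_of_prod {G G' : Type*} [NormedAddCommGroup G] [NormedAddCommGroup G']
    {b : X → G} {b' : X → G'} (h : IncrBigO l b b') :
    IncrBigO l (fun x => (b x, a x)) fun x => (b' x, a x) :=
  (h.trans (IncrBigO.fst (a := fun x => (b' x, a x)) l)).prodMk
    (IncrBigO.snd (a := fun x => (b' x, a x)) l)

end ChangeOfCharts

section SquashNearBoundary

variable {E : Type*} [NormedAddCommGroup E] [NormedSpace ℝ E] [FiniteDimensional ℝ E]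
  {H : Type*} [TopologicalSpace H]
  {I : ModelWithCorners ℝ E H} {M : Type*} [TopologicalSpace M] [ChartedSpace H M]
  [IsManifold I ∞ M] {d : M → ℝ} {K : M × ℝ → M}

/-- On the boundary the squash is the identity for every `w`, so there the map is injective and
expanding. The other conditions hold near the boundary as well, and compactness of `M × [0, 3]`
gives a uniform neighbourhood. -/
theorem squash_near_boundary [IsHalfSpaceModel I] [T2Space M] [CompactSpace M]
    (hd : IsBoundaryDefining I d)
    (hK : ContMDiff (I.prod 𝓘(ℝ, ℝ)) I ∞ K) (hKb : ∀ x ∈ I.boundary M, ∀ w, K (x, w) = x)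
    (hK0 : ∀ x ∈ I.boundary M, ∀ᶠ y in 𝓝 x, K (y, 0) ∈ I.boundary M) {N : Set M}
    (hN : N ∈ 𝓝ˢ (I.boundary M)) :
    ∃ η > 0, InjOn (fun q : M × ℝ => (K q, d q.1, q.2)) {q | q.2 ∈ Icc 0 3 ∧ d q.1 < η} ∧
      ∀ x, d x < η → K (x, 0) ∈ I.boundary M ∧ ∀ w ∈ Icc (0 : ℝ) 3, K (x, w) ∈ N ∧
        IncrBigO (𝓝 (x, w)) (fun q : M × ℝ => (extChartAt I x q.1, q.2))
          (fun q : M × ℝ => (extChartAt I (K (x, w)) (K q), d q.1, q.2)) := by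
  set C : Set (M × ℝ) := univ ×ˢ Icc 0 3 with hC
  have hCc : IsCompact C := isCompact_univ.prod isCompact_Icc
  have hρ : Continuous fun q : M × ℝ => d q.1 := hd.contMDiff.continuous.comp continuous_fst
  have hexp : ∀ q ∈ C, d q.1 = 0 → IncrBigO (𝓝 q)
      (fun y : M × ℝ => (extChartAt I q.1 y.1, y.2))
      (fun y : M × ℝ => (extChartAt I q.1 (K y), d y.1, y.2)) := fun q _ hq =>
    squash_incrBigO hd hK hKb ((hd.eq_zero_iff _).1 hq) q.2
  obtain ⟨η₁, hη₁, h1⟩ := exists_pos_injOn_of_isCompact hCc hρ (fun q _ => hd.nonneg q.1)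
    (f := fun q : M × ℝ => (K q, d q.1, q.2))
    (hK.continuous.prodMk (hρ.prodMk continuous_snd)).continuousOn (by
      rintro ⟨x, w⟩ hx ⟨y, w'⟩ hy hxy
      simp only [Prod.mk.injEq] at hxy
      rw [hKb x ((hd.eq_zero_iff x).1 hx.2), hKb y ((hd.eq_zero_iff y).1 hy.2)] at hxy
      exact Prod.ext hxy.1 hxy.2.2) (by
      rintro ⟨x, w⟩ hx hx0
      obtain ⟨u, hu, hinj⟩ := (hexp (x, w) hx hx0).eventually_injOn
        ⟨(extChartAt I x).source ×ˢ univ,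
          prod_mem_nhds (extChartAt_source_mem_nhds x) univ_mem, fun y hy y' hy' h =>
          Prod.ext ((extChartAt I x).injOn hy.1 hy'.1 (Prod.mk.inj h).1)
            (Prod.mk.inj h).2⟩
      refine ⟨u ∩ K ⁻¹' (extChartAt I x).source, nhdsWithin_le_nhds (inter_mem hu ?_),
        fun y hy y' hy' h => hinj hy.1 hy'.1 ?_⟩
      · refine hK.continuous.continuousAt ?_
        rw [hKb x ((hd.eq_zero_iff x).1 hx0)]
        exact extChartAt_source_mem_nhds x
      · simp only [Prod.mk.injEq] at h ⊢
        exact ⟨by rw [h.1], h.2⟩)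
  obtain ⟨η₂, hη₂, h2⟩ := exists_pos_forall_lt_of_isCompact hCc hρ (fun q _ => hd.nonneg q.1)
    (P := fun q => K (q.1, 0) ∈ I.boundary M ∧ K q ∈ N ∧
      IncrBigO (𝓝 q) (fun y : M × ℝ => (extChartAt I q.1 y.1, y.2))
      (fun y : M × ℝ => (extChartAt I (K q) (K y), d y.1, y.2))) (by
    rintro ⟨x, w⟩ hxC hx0
    have hx : x ∈ I.boundary M := (hd.eq_zero_iff x).1 hx0
    refine Eventually.filter_mono nhdsWithin_le_nhds ?_
    have hKc : Tendsto K (𝓝 (x, w)) (𝓝 x) := by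
      have := hK.continuous.tendsto (x, w)
      rwa [hKb x hx] at this
    have he := (hexp (x, w) hxC hx0)
    rw [← nhdsWithin_univ] at he
    have he' := he.eventually_nhdsWithin
    simp only [nhdsWithin_univ] at he'
    filter_upwards [(continuous_fst.tendsto (x, w)).eventually (hK0 x hx),
      hKc (mem_nhdsSet_iff_forall.1 hN x hx), hKc (extChartAt_source_mem_nhds (I := I) x), he',
      (continuous_fst.tendsto (x, w)) (extChartAt_source_mem_nhds (I := I) x)] with q hq1 hq2 hq3
      hq4 hq5
    refine ⟨hq1, hq2, ?_⟩
    have hA : IncrBigO (𝓝 q) (fun y : M × ℝ => (extChartAt I q.1 y.1, y.2))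
        (fun y : M × ℝ => (extChartAt I x y.1, y.2)) :=
      IncrBigO.prod_of_prod ((extChartAt_incrBigO_extChartAt (mem_extChartAt_source q.1)
        hq5).comp_tendsto (continuous_fst.tendsto q))
    have hB : IncrBigO (𝓝 q) (fun y : M × ℝ => (extChartAt I x (K y), d y.1, y.2))
        (fun y : M × ℝ => (extChartAt I (K q) (K y), d y.1, y.2)) :=
      IncrBigO.prod_of_prod ((extChartAt_incrBigO_extChartAt hq3
        (mem_extChartAt_source (K q))).comp_tendsto (hK.continuous.tendsto q))
    exact hA.trans (hq4.trans hB))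
  refine ⟨min η₁ η₂, lt_min hη₁ hη₂, h1.mono ?_, fun x hx => ?_⟩
  · rintro q ⟨hq, hq'⟩
    exact ⟨⟨trivial, hq⟩, lt_of_lt_of_le hq' (min_le_left _ _)⟩
  have hx2 := hx.trans_le (min_le_right _ _)
  refine ⟨(h2 (x, 0) ⟨trivial, by norm_num⟩ hx2).1, fun w hw => ?_⟩
  exact (h2 (x, w) ⟨trivial, hw⟩ hx2).2

end SquashNearBoundary

/-! ### Collars of submanifolds of the boundary -/

section Collar

variable {E : Type*} [NormedAddCommGroup E] [NormedSpace ℝ E] [FiniteDimensional ℝ E]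
  {H : Type*} [TopologicalSpace H]
  {I : ModelWithCorners ℝ E H} {M : Type*} [TopologicalSpace M] [ChartedSpace H M]
  [IsManifold I ∞ M]
  {E' : Type*} [NormedAddCommGroup E'] [NormedSpace ℝ E'] [FiniteDimensional ℝ E']
  {H' : Type*} [TopologicalSpace H'] {J : ModelWithCorners ℝ E' H'} {B : Type*}
  [TopologicalSpace B] [ChartedSpace H' B] [IsManifold J ∞ B] {d : M → ℝ} {Φ : M × ℝ → M}
  {j : B → M} {ε : ℝ}

/-- The linear growth of `d` along the push forces the `s`-component of a vector in the kernel to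
vanish. At `s = 0` the map is `j`, an immersion. -/
theorem collar_incrBigO [IsHalfSpaceModel I] [J.Boundaryless] (hd : IsBoundaryDefining I d)
    (hε : 0 < ε)
    (hΦ : ContMDiffOn (I.prod 𝓘(ℝ, ℝ)) I ∞ Φ (univ ×ˢ Icc 0 ε)) (hΦ0 : ∀ y, Φ (y, 0) = y)
    (hΦd : ∀ y ∈ I.boundary M, (fun q : M × ℝ => q.2) =O[𝓝 y ×ˢ 𝓝[≥] 0] (d ∘ Φ))
    (hj : ContMDiff J I ∞ j) (hjb : ∀ b, j b ∈ I.boundary M) {b : B}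
    (hinj : Function.Injective (mfderiv J I j b)) :
    IncrBigO (𝓝[univ ×ˢ Icc 0 ε] (b, (0 : ℝ))) (fun q : B × ℝ => (extChartAt J b q.1, q.2))
      (fun q : B × ℝ => extChartAt I (j b) (Φ (j q.1, q.2))) := by
  have : IsManifold I 1 M := .of_le (n := ∞) (by simp)
  have : IsManifold J 1 B := .of_le (n := ∞) (by simp)
  obtain ⟨ℓ, hℓ⟩ := IsHalfSpaceModel.exists_range_eq (I := I)
  have hx := hjb b
  have h0 := ne_zero_of_mem_boundary hℓ hx
  have hxs := mem_extChartAt_source (I := I) (j b)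
  set φ := extChartAt I (j b) with hφ
  set ψ := extChartAt J b with hψ
  set z := ψ b with hz
  set a : B × ℝ → E := fun q => φ (Φ (j q.1, q.2)) with ha
  have hΨ : ContMDiffWithinAt (J.prod 𝓘(ℝ, ℝ)) I 1 (fun q : B × ℝ => Φ (j q.1, q.2))
      (univ ×ˢ Icc 0 ε) (b, 0) :=
    ((hΦ.comp ((hj.comp contMDiff_fst).prodMk contMDiff_snd).contMDiffOn
      (s := univ ×ˢ Icc 0 ε) fun q hq => ⟨trivial, hq.2⟩) (b, 0)
      ⟨trivial, by simp [hε.le]⟩).of_le (by simp)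
  have has : ContMDiffWithinAt (J.prod 𝓘(ℝ, ℝ)) 𝓘(ℝ, E) 1 a (univ ×ˢ Icc 0 ε) (b, 0) := by
    refine ContMDiffAt.comp_contMDiffWithinAt (b, (0 : ℝ)) (g := φ) ?_ hΨ
    simp only [hΦ0]
    exact contMDiffAt_extChartAt
  have key := extChartAt_incrBigO_of_contMDiffWithinAt (I := J.prod 𝓘(ℝ, ℝ))
    (S := univ ×ˢ Icc 0 ε) (p := (b, 0)) (x := (b, (0 : ℝ))) (a := a) (mem_extChartAt_source _)
    ⟨trivial, by simp [hε.le]⟩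
    (by rw [extChartAt_prod_space_symm_preimage]; exact J.convex_range.prod (convex_Icc _ _))
    has ?_
  · rw [extChartAt_prod_space] at key
    exact key
  have hbase : extChartAt (J.prod 𝓘(ℝ, ℝ)) (b, (0 : ℝ)) (b, (0 : ℝ)) = (z, 0) := by
    rw [extChartAt_prod_space]; rfl
  rw [extChartAt_prod_space_symm_preimage, hbase, J.range_eq_univ]
  set g : E' × ℝ → E := a ∘ (extChartAt (J.prod 𝓘(ℝ, ℝ)) (b, (0 : ℝ))).symm with hg
  have hgq : ∀ q, g q = φ (Φ (j (ψ.symm q.1), q.2)) := fun q => by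
    simp only [hg, Function.comp, extChartAt_prod_space]
    rfl
  intro g' hg'
  have hcone : ∀ v : E', ∀ ξ : ℝ, 0 ≤ ξ →
      ∀ᶠ t : ℝ in 𝓝[≥] 0, (z, (0 : ℝ)) + t • (v, ξ) ∈ (univ : Set E') ×ˢ Icc 0 ε := by
    intro v ξ hξ
    have h1 : ∀ᶠ t : ℝ in 𝓝[≥] 0, t * ξ < ε := by
      have : Tendsto (fun t : ℝ => t * ξ) (𝓝[≥] 0) (𝓝 (0 * ξ)) :=
        (tendsto_id.mul_const ξ).mono_left nhdsWithin_le_nhds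
      rw [zero_mul] at this
      exact this.eventually (gt_mem_nhds hε)
    filter_upwards [h1, self_mem_nhdsWithin] with t ht ht0
    refine ⟨trivial, ?_⟩
    simp only [Prod.snd_add, Prod.smul_snd, zero_add, smul_eq_mul]
    exact ⟨mul_nonneg ht0 hξ, ht.le⟩
  have hlim : ∀ v : E', Tendsto (fun t : ℝ => ψ.symm (z + t • v)) (𝓝[≥] 0) (𝓝 b) := fun v =>
    Tendsto.comp (map_extChartAt_symm_nhdsWithin_range (I := J) b).le
      (tendsto_add_smul_nhdsWithin (by simp [J.range_eq_univ]))
  have hgz : g (z, 0) = φ (j b) := by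
    rw [hgq]
    simp only [hz]
    rw [ψ.left_inv (mem_extChartAt_source b), hΦ0]
  suffices h : ∀ v : E', ∀ ξ : ℝ, 0 ≤ ξ → g' (v, ξ) = 0 → v = 0 ∧ ξ = 0 by
    rintro ⟨v, ξ⟩ hv
    rcases le_total 0 ξ with hl | hl
    · obtain ⟨rfl, rfl⟩ := h v ξ hl hv
      rfl
    · have := h (-v) (-ξ) (by linarith)
        (by rw [show ((-v, -ξ) : E' × ℝ) = -(v, ξ) from rfl, map_neg, hv, neg_zero])
      simp only [neg_eq_zero] at this
      rw [this.1, this.2]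
      rfl
  intro v ξ hξ hgv
  have hξ0 : ξ = 0 := by
    have hO : (fun q : M × ℝ => q.2) =O[𝓝 (j b) ×ˢ 𝓝[≥] 0] fun q => ℓ (φ (Φ q)) := by
      refine (hΦd _ hx).trans ((hd.isBigO_height hℓ hx hxs).comp_tendsto ?_)
      have h2 := (hΦ.continuousOn (j b, 0) ⟨trivial, by simp [hε.le]⟩).tendsto
      rw [nhdsWithin_prod_eq, nhdsWithin_univ, nhdsWithin_Icc_eq_nhdsGE hε, hΦ0] at h2
      exact h2
    obtain ⟨C, hC, hB⟩ := hO.exists_pos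
    have ht1 : Tendsto (fun t : ℝ => (j (ψ.symm (z + t • v)), t * ξ)) (𝓝[≥] 0)
        (𝓝 (j b) ×ˢ 𝓝[≥] 0) := by
      refine ((hj.continuous.tendsto b).comp (hlim v)).prodMk (tendsto_nhdsWithin_iff.2 ⟨?_, ?_⟩)
      · have : Tendsto (fun t : ℝ => t * ξ) (𝓝[≥] 0) (𝓝 (0 * ξ)) :=
          (tendsto_id.mul_const ξ).mono_left nhdsWithin_le_nhds
        rwa [zero_mul] at this
      · filter_upwards [self_mem_nhdsWithin] with t ht using mul_nonneg ht hξ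
    have ht2 : Tendsto (fun t : ℝ => Φ (j (ψ.symm (z + t • v)), t * ξ)) (𝓝[≥] 0) (𝓝 (j b)) := by
      have h2 := (hΦ.continuousOn (j b, 0) ⟨trivial, by simp [hε.le]⟩).tendsto
      rw [nhdsWithin_prod_eq, nhdsWithin_univ, nhdsWithin_Icc_eq_nhdsGE hε, hΦ0] at h2
      exact h2.comp ht1
    have h2 := HasFDerivWithinAt.apply_nonneg (g := fun q => ℓ (g q)) (g' := ℓ.comp g')
      (v := (v, ξ)) (a := ξ / C) (ℓ.hasFDerivAt.comp_hasFDerivWithinAt _ hg')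
      (hcone v ξ hξ) (by rw [hgz]; exact (mem_boundary_iff hℓ h0 hxs).1 hx) (by
        filter_upwards [ht1.eventually hB.bound, ht2 (extChartAt_source_mem_nhds (I := I) (j b)),
          self_mem_nhdsWithin] with t ht ht' ht0
        have ht0' : 0 ≤ t := ht0
        rw [Real.norm_of_nonneg (mul_nonneg ht0' hξ),
          Real.norm_of_nonneg (apply_extChartAt_nonneg hℓ ht')] at ht
        rw [hgq, ← mul_div_assoc, div_le_iff₀' hC]
        simp only [Prod.fst_add, Prod.snd_add, Prod.smul_fst, Prod.smul_snd, zero_add, smul_eq_mul]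
        exact ht)
    have h4 : ξ / C ≤ 0 := by simpa [hgv] using h2
    have h6 : ξ / C = 0 := le_antisymm h4 (div_nonneg hξ hC.le)
    exact (div_eq_zero_iff.1 h6).resolve_right hC.ne'
  subst hξ0
  refine ⟨?_, rfl⟩
  set D : E' →L[ℝ] E := mfderiv J I j b with hD
  have hjd : HasFDerivWithinAt (writtenInExtChartAt J I b j) D (range J) z :=
    ((hj b).mdifferentiableAt (by simp)).hasMFDerivAt.2
  have h1 := hasDerivWithinAt_comp_add_smul hg' (hcone v 0 le_rfl)
  have h2 := hasDerivWithinAt_comp_add_smul (v := v) hjd (by simp [J.range_eq_univ])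
  have h3 : (fun t : ℝ => g ((z, 0) + t • (v, 0))) =
      fun t : ℝ => writtenInExtChartAt J I b j (z + t • v) := by
    funext t
    rw [hgq]
    simp [writtenInExtChartAt, hΦ0, hφ, hψ]
  rw [h3] at h1
  have h4 := (uniqueDiffOn_Ici (0 : ℝ) 0 (mem_Ici.2 le_rfl)).eq_deriv _ h1 h2
  exact hinj ((h4.symm.trans hgv).trans (map_zero D).symm)

/-- A collar of a closed submanifold of the boundary, inside a given neighbourhood of the
boundary. -/
theorem exists_collar [IsHalfSpaceModel I] [J.Boundaryless] [T2Space M] [CompactSpace M]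
    [CompactSpace B] (hd : IsBoundaryDefining I d) (hj : IsDiffEmbedding J I j)
    (hjb : ∀ b, j b ∈ I.boundary M) {N : Set M} (hN : N ∈ 𝓝ˢ (I.boundary M)) :
    ∃ ε > 0, ∃ Ψ : B × ℝ → M,
      ContMDiffOn (J.prod 𝓘(ℝ, ℝ)) I ∞ Ψ (univ ×ˢ Icc 0 ε) ∧ InjOn Ψ (univ ×ˢ Icc 0 ε) ∧
      (∀ b, Ψ (b, 0) = j b) ∧ (∀ b, ∀ s ∈ Ioc 0 ε, Ψ (b, s) ∉ I.boundary M) ∧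
      (∀ b, (fun q : B × ℝ => q.2) =O[𝓝 b ×ˢ 𝓝[≥] 0] (d ∘ Ψ)) ∧
      ∀ q ∈ univ ×ˢ Icc 0 ε, Ψ q ∈ N ∧ IncrBigO (𝓝[univ ×ˢ Icc 0 ε] q)
        (fun y : B × ℝ => (extChartAt J q.1 y.1, y.2)) (extChartAt I (Ψ q) ∘ Ψ) := by
  obtain ⟨ε, hε, Φ, hΦ, hΦ0, hΦb, hΦd⟩ := exists_boundary_push I hd
  set Ψ : B × ℝ → M := fun q => Φ (j q.1, q.2) with hΨ
  set C : Set (B × ℝ) := univ ×ˢ Icc 0 ε with hC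
  have hCc : IsCompact C := isCompact_univ.prod isCompact_Icc
  have hΨs : ContMDiffOn (J.prod 𝓘(ℝ, ℝ)) I ∞ Ψ C :=
    hΦ.comp ((hj.contMDiff.comp contMDiff_fst).prodMk contMDiff_snd).contMDiffOn fun q hq =>
      ⟨trivial, hq.2⟩
  have hΨ0 : ∀ b, Ψ (b, 0) = j b := fun b => hΦ0 _
  have hexp : ∀ b, IncrBigO (𝓝[C] (b, (0 : ℝ))) (fun q : B × ℝ => (extChartAt J b q.1, q.2))
      (extChartAt I (j b) ∘ Ψ) := fun b =>
    collar_incrBigO hd hε hΦ hΦ0 hΦd hj.contMDiff hjb (hj.mfderiv_injective b)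
  have hΨc : ∀ b, Tendsto Ψ (𝓝[C] (b, 0)) (𝓝 (j b)) := fun b => by
    have := (hΨs.continuousOn (b, 0) ⟨trivial, by simp [hε.le]⟩).tendsto
    rwa [hΨ0] at this
  obtain ⟨η₁, hη₁, h1⟩ := exists_pos_injOn_of_isCompact hCc (ρ := fun q : B × ℝ => q.2)
    continuous_snd
    (fun q hq => hq.2.1) hΨs.continuousOn (by
      rintro ⟨b, s⟩ hb ⟨b', s'⟩ hb' h
      obtain ⟨rfl⟩ : s = 0 := hb.2
      obtain ⟨rfl⟩ : s' = 0 := hb'.2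
      rw [hΨ0, hΨ0] at h
      rw [hj.isEmbedding.injective h]) (by
      rintro ⟨b, s⟩ hb hs
      obtain ⟨rfl⟩ : s = 0 := hs
      obtain ⟨u, hu, hinj⟩ := (hexp b).eventually_injOn
        ⟨(extChartAt J b).source ×ˢ univ, nhdsWithin_le_nhds
          (prod_mem_nhds (extChartAt_source_mem_nhds b) univ_mem), fun y hy y' hy' h =>
          Prod.ext ((extChartAt J b).injOn hy.1 hy'.1 (Prod.mk.inj h).1)
            (Prod.mk.inj h).2⟩
      exact ⟨u, hu, fun y hy y' hy' h => hinj hy hy' (congrArg (extChartAt I (j b)) h)⟩)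
  obtain ⟨η₂, hη₂, h2⟩ := exists_pos_forall_lt_of_isCompact hCc (ρ := fun q : B × ℝ => q.2)
    continuous_snd
    (fun q hq => hq.2.1) (P := fun q => Ψ q ∈ N ∧ IncrBigO (𝓝[C] q)
        (fun y : B × ℝ => (extChartAt J q.1 y.1, y.2)) (extChartAt I (Ψ q) ∘ Ψ)) (by
    rintro ⟨b, s⟩ hb hs
    obtain ⟨rfl⟩ : s = 0 := hs
    filter_upwards [hΨc b (mem_nhdsSet_iff_forall.1 hN _ (hjb b)),
      (hexp b).eventually_nhdsWithin, hΨc b (extChartAt_source_mem_nhds (I := I) (j b)),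
      nhdsWithin_le_nhds ((continuous_fst.tendsto (b, (0 : ℝ)))
        (extChartAt_source_mem_nhds (I := J) b)), self_mem_nhdsWithin] with q hq1 hq2 hq3 hq4 hq5
    refine ⟨hq1, IncrBigO.trans ?_ (hq2.change_chart_right (hΨs.continuousOn q hq5) hq3
      (mem_extChartAt_source _))⟩
    exact IncrBigO.prod_of_prod (((extChartAt_incrBigO_extChartAt (mem_extChartAt_source q.1)
        hq4).comp_tendsto (continuous_fst.tendsto q)).mono nhdsWithin_le_nhds))
  -- Halving turns the strict bounds `s < η₁` and `s < η₂` into ones valid on the closed interval.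
  set ε' := min ε (min η₁ η₂ / 2) with hε'
  have hmin : 0 < min η₁ η₂ := lt_min hη₁ hη₂
  have hε'0 : 0 < ε' := lt_min hε (by positivity)
  have hε'ε : ε' ≤ ε := min_le_left _ _
  have hε'η : ε' < min η₁ η₂ := (min_le_right _ _).trans_lt (by linarith)
  have hsub : (univ ×ˢ Icc 0 ε' : Set (B × ℝ)) ⊆ C :=
    prod_mono_right (Icc_subset_Icc_right hε'ε)
  refine ⟨ε', hε'0, Ψ, hΨs.mono hsub, h1.mono ?_, hΨ0,
    fun b s hs => hΦb _ (hjb b) s ⟨hs.1, hs.2.trans hε'ε⟩, fun b => ?_, fun q hq => ?_⟩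
  · intro q hq
    exact ⟨hsub hq, hq.2.2.trans_lt (hε'η.trans_le (min_le_left _ _))⟩
  · exact (hΦd _ (hjb b)).comp_tendsto
      (((hj.contMDiff.continuous.tendsto b).comp tendsto_fst).prodMk tendsto_snd)
  · obtain ⟨h3, h4⟩ := h2 q (hsub hq) (hq.2.2.trans_lt (hε'η.trans_le (min_le_right _ _)))
    exact ⟨h3, h4.mono (nhdsWithin_mono _ hsub)⟩

end Collar

/-! ### From injective differentials to increment estimates -/

section DerivativeCriterion

variable {E : Type*} [NormedAddCommGroup E] [NormedSpace ℝ E] [FiniteDimensional ℝ E]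
  {H : Type*} [TopologicalSpace H] {I : ModelWithCorners ℝ E H} {M : Type*} [TopologicalSpace M]
  [ChartedSpace H M] [IsManifold I ∞ M]
  {E' : Type*} [NormedAddCommGroup E'] [NormedSpace ℝ E']
  {H' : Type*} [TopologicalSpace H'] {J : ModelWithCorners ℝ E' H'} {N : Type*}
  [TopologicalSpace N] [ChartedSpace H' N]

theorem incrBigO_of_mfderivWithin_injective {S : Set M} {x : M} {f : M → N} (hxS : x ∈ S)
    (hS : Convex ℝ ((extChartAt I x).symm ⁻¹' S ∩ range I))
    (hu : UniqueDiffWithinAt ℝ ((extChartAt I x).symm ⁻¹' S ∩ range I) (extChartAt I x x))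
    (hf : ContMDiffWithinAt I J 1 f S x) (hinj : Function.Injective (mfderivWithin I J f S x)) :
    IncrBigO (𝓝[S] x) (extChartAt I x) (extChartAt J (f x) ∘ f) := by
  have : IsManifold I 1 M := .of_le (n := ∞) (by simp)
  refine extChartAt_incrBigO_of_contMDiffWithinAt (mem_extChartAt_source x) hxS hS
    (contMDiffWithinAt_iff_target.1 hf).2 fun g' hg' v hv => ?_
  set D : E →L[ℝ] E' := mfderivWithin I J f S x with hD
  have hd : HasFDerivWithinAt (writtenInExtChartAt I J x f) D
      ((extChartAt I x).symm ⁻¹' S ∩ range I) (extChartAt I x x) :=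
    (hf.mdifferentiableWithinAt one_ne_zero).hasMFDerivWithinAt.2
  have h : g' = D := hu.eq hg' hd
  exact hinj ((congrArg (fun L : E →L[ℝ] E' => L v) h).symm.trans
    (hv.trans (map_zero D).symm))

theorem incrBigO_of_mfderiv_injective {x : M} {f : M → N} (hf : ContMDiffAt I J 1 f x)
    (hinj : Function.Injective (mfderiv I J f x)) :
    IncrBigO (𝓝 x) (extChartAt I x) (extChartAt J (f x) ∘ f) := by
  rw [← nhdsWithin_univ]
  refine incrBigO_of_mfderivWithin_injective trivial ?_ ?_ hf.contMDiffWithinAt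
    (by rwa [mfderivWithin_univ])
  · rw [preimage_univ, univ_inter]
    exact I.convex_range
  · rw [preimage_univ, univ_inter]
    exact I.uniqueDiffOn _ (mem_range_self _)

end DerivativeCriterion

/-! ### The path in the disc and the flattening function -/

section DiscPath

/-- The segment in the unit disc from `1` to `exp (2πiτ)`, parametrized by `0 ≤ w ≤ 1 / 2`. -/
noncomputable def discPath (τ w : ℝ) : ℂ :=
  (1 - Real.smoothTransition (2 * w)) • (1 : ℂ) +
    Real.smoothTransition (2 * w) • Complex.exp (2 * Real.pi * τ * Complex.I)

theorem norm_exp_two_pi_mul (τ : ℝ) : ‖Complex.exp (2 * Real.pi * τ * Complex.I)‖ = 1 := by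
  have := Complex.norm_exp_ofReal_mul_I (2 * Real.pi * τ)
  push_cast at this
  exact this

theorem discPath_mem (τ w : ℝ) : discPath τ w ∈ Metric.closedBall (0 : ℂ) 1 := by
  refine (convex_closedBall (0 : ℂ) 1) (by simp) (by simp [norm_exp_two_pi_mul]) ?_ ?_ (by ring)
  · linarith [Real.smoothTransition.le_one (2 * w)]
  · exact Real.smoothTransition.nonneg _

theorem discPath_of_half_le {w : ℝ} (τ : ℝ) (hw : 1 / 2 ≤ w) :
    discPath τ w = Complex.exp (2 * Real.pi * τ * Complex.I) := by
  simp [discPath, Real.smoothTransition.one_of_one_le (show 1 ≤ 2 * w by linarith)]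

theorem discPath_zero (τ : ℝ) : discPath τ 0 = 1 := by simp [discPath]

/-- Both ends of the segment are `1`. Hence near the binding a full number of turns has no effect at
all. -/
theorem discPath_intCast (k : ℤ) (w : ℝ) : discPath k w = 1 := by
  have : Complex.exp (2 * Real.pi * (k : ℝ) * Complex.I) = 1 := by
    rw [Complex.exp_eq_one_iff]
    exact ⟨k, by push_cast; ring⟩
  rw [discPath, this, ← add_smul]
  simp

theorem contDiff_discPath : ContDiff ℝ ∞ fun q : ℝ × ℝ => discPath q.1 q.2 := by
  have h : ContDiff ℝ ∞ fun q : ℝ × ℝ => Real.smoothTransition (2 * q.2) :=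
    (Real.smoothTransition.contDiff (n := ⊤)).comp (contDiff_const.mul contDiff_snd)
  refine ((contDiff_const.sub h).smul contDiff_const).add (h.smul ?_)
  have h1 : ContDiff ℝ ∞ fun q : ℝ × ℝ => (q.1 : ℂ) := Complex.ofRealCLM.contDiff.comp contDiff_fst
  exact ((contDiff_const.mul h1).mul contDiff_const).cexp

/-- A smooth function that is the identity on `(-∞, 3]` and constant on `[4, ∞)`. -/
noncomputable def flatten (w : ℝ) : ℝ :=
  (1 - Real.smoothTransition (w - 3)) * w + Real.smoothTransition (w - 3) * 4

theorem contDiff_flatten : ContDiff ℝ ∞ flatten := by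
  have h : ContDiff ℝ ∞ fun w : ℝ => Real.smoothTransition (w - 3) :=
    (Real.smoothTransition.contDiff (n := ⊤)).comp (contDiff_id.sub contDiff_const)
  exact ((contDiff_const.sub h).mul contDiff_id).add (h.mul contDiff_const)

theorem flatten_of_le_three {w : ℝ} (hw : w ≤ 3) : flatten w = w := by
  simp [flatten, Real.smoothTransition.zero_of_nonpos (show w - 3 ≤ 0 by linarith)]

theorem flatten_of_four_le {w : ℝ} (hw : 4 ≤ w) : flatten w = 4 := by
  simp [flatten, Real.smoothTransition.one_of_one_le (show 1 ≤ w - 3 by linarith)]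

/-- Although flattening need not be injective beyond `3`, it still separates levels up to `3` from
levels above. -/
theorem three_lt_flatten {w : ℝ} (hw : 3 < w) : 3 < flatten w := by
  have h0 := Real.smoothTransition.nonneg (w - 3)
  have h1 := Real.smoothTransition.le_one (w - 3)
  simp only [flatten]
  rcases h0.eq_or_lt with h | h
  · rw [← h]
    linarith
  · nlinarith [mul_nonneg (sub_nonneg.2 h1) (sub_nonneg.2 hw.le)]

theorem flatten_le_four (w : ℝ) : flatten w ≤ 4 := by
  have h0 := Real.smoothTransition.nonneg (w - 3)
  have h1 := Real.smoothTransition.le_one (w - 3)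
  rcases le_total w 4 with h | h
  · simp only [flatten]
    nlinarith
  · exact (flatten_of_four_le h).le

end DiscPath

/-! ### Boundary retractions with uniform constants -/

section Retraction

variable {E : Type*} [NormedAddCommGroup E] [NormedSpace ℝ E] {H : Type*} [TopologicalSpace H]
  {I : ModelWithCorners ℝ E H} {V : Type*} [TopologicalSpace V] [ChartedSpace H V]

/-- A smooth deformation of the identity of `V`, supported near the boundary, into a map that
retracts a neighbourhood of the boundary onto the boundary; all of this happens where the boundary
defining function `d` is less than `5 * δ`, and there points map into `N`. -/
structure BoundaryRetraction (I : ModelWithCorners ℝ E H) (N : Set V) where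
  d : V → ℝ
  K : V × ℝ → V
  δ : ℝ
  δ_pos : 0 < δ
  isBoundaryDefining : IsBoundaryDefining I d
  contMDiff : ContMDiff (I.prod 𝓘(ℝ, ℝ)) I ∞ K
  of_mem_boundary : ∀ x ∈ I.boundary V, ∀ w, K (x, w) = x
  of_two_le : ∀ x w, 2 ≤ w → K (x, w) = x
  of_le_one : ∀ x w, w ≤ 1 → K (x, w) = K (x, 0)
  injOn : InjOn (fun q : V × ℝ => (K q, d q.1, q.2)) {q | q.2 ∈ Icc 0 3 ∧ d q.1 < 5 * δ}
  mem_boundary : ∀ x, d x < 5 * δ → K (x, 0) ∈ I.boundary V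
  mem : ∀ x, d x < 5 * δ → ∀ w ∈ Icc (0 : ℝ) 3, K (x, w) ∈ N
  incrBigO : ∀ x, d x < 5 * δ → ∀ w ∈ Icc (0 : ℝ) 3,
    IncrBigO (𝓝 (x, w)) (fun q : V × ℝ => (extChartAt I x q.1, q.2))
      (fun q : V × ℝ => (extChartAt I (K (x, w)) (K q), d q.1, q.2))

theorem BoundaryRetraction.exists_le [FiniteDimensional ℝ E] [IsManifold I ∞ V]
    [IsHalfSpaceModel I] [T2Space V] [CompactSpace V] {N : Set V}
    (hN : N ∈ 𝓝ˢ (I.boundary V)) {ε : ℝ} (hε : 0 < ε) :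
    ∃ R : BoundaryRetraction I N, R.δ ≤ ε := by
  obtain ⟨d, hd⟩ := exists_isBoundaryDefining I V
  obtain ⟨K, hK, hKb, hK2, hK1, hK0⟩ := exists_boundary_squash I V
  obtain ⟨η, hη, hinj, hnear⟩ := squash_near_boundary hd hK hKb hK0 hN
  have hδ : 5 * min ε (η / 5) ≤ η := by linarith [min_le_right ε (η / 5)]
  have hinj' : InjOn (fun q : V × ℝ => (K q, d q.1, q.2))
      {q | q.2 ∈ Icc 0 3 ∧ d q.1 < 5 * min ε (η / 5)} := by
    refine hinj.mono ?_
    rintro q ⟨hq, hq'⟩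
    exact ⟨hq, lt_of_lt_of_le hq' hδ⟩
  exact ⟨{
    d := d
    K := K
    δ := min ε (η / 5)
    δ_pos := lt_min hε (by positivity)
    isBoundaryDefining := hd
    contMDiff := hK
    of_mem_boundary := hKb
    of_two_le := hK2
    of_le_one := hK1
    injOn := hinj'
    mem_boundary := fun x hx => (hnear x (hx.trans_le hδ)).1
    mem := fun x hx w hw => ((hnear x (hx.trans_le hδ)).2 w hw).1
    incrBigO := fun x hx w hw => ((hnear x (hx.trans_le hδ)).2 w hw).2 }, min_le_left _ _⟩

namespace BoundaryRetraction

variable {N : Set V} (R : BoundaryRetraction I N)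

/-- The boundary defining function, rescaled. -/
noncomputable def level (x : V) : ℝ := R.d x / R.δ

/-- The boundary defining function, made constant away from the boundary. -/
noncomputable def depth (x : V) : ℝ := R.δ * flatten (R.level x)

theorem contMDiff_level : ContMDiff I 𝓘(ℝ, ℝ) ∞ R.level := by
  have : ContDiff ℝ ∞ fun s : ℝ => s / R.δ := contDiff_id.div_const _
  exact this.contMDiff.comp R.isBoundaryDefining.contMDiff

theorem contMDiff_depth : ContMDiff I 𝓘(ℝ, ℝ) ∞ R.depth :=
  (contDiff_const.mul contDiff_flatten).contMDiff.comp R.contMDiff_level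

theorem d_eq (x : V) : R.d x = R.δ * R.level x := by
  have := R.δ_pos.ne'
  simp only [level]
  field_simp

theorem d_lt {x : V} (hx : R.level x < 5) : R.d x < 5 * R.δ := by
  rw [R.d_eq]
  nlinarith [R.δ_pos]

theorem level_eq_zero_iff (x : V) : R.level x = 0 ↔ x ∈ I.boundary V := by
  rw [← R.isBoundaryDefining.eq_zero_iff, level, div_eq_zero_iff]
  simp [R.δ_pos.ne']

theorem depth_of_level_le_three {x : V} (hx : R.level x ≤ 3) : R.depth x = R.d x := by
  rw [depth, flatten_of_le_three hx, d_eq]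

theorem depth_mem (x : V) : R.depth x ∈ Icc 0 (4 * R.δ) := by
  have := R.δ_pos
  constructor
  · rcases le_or_gt (R.level x) 3 with h | h
    · rw [R.depth_of_level_le_three h]
      exact R.isBoundaryDefining.nonneg x
    · exact mul_nonneg this.le (by linarith [three_lt_flatten h])
  · rw [depth]
    nlinarith [flatten_le_four (R.level x)]

theorem level_le_three_of_depth {x y : V} (hx : R.level x ≤ 3) (h : R.depth x = R.depth y) :
    R.level y ≤ 3 := by
  by_contra! hy
  have h1 := three_lt_flatten hy
  rw [R.depth_of_level_le_three hx, R.d_eq] at h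
  have := mul_left_cancel₀ R.δ_pos.ne' h
  linarith

theorem depth_eq_zero_iff (x : V) : R.depth x = 0 ↔ x ∈ I.boundary V := by
  rw [← R.isBoundaryDefining.eq_zero_iff]
  rcases le_or_gt (R.level x) 3 with h | h
  · rw [R.depth_of_level_le_three h]
  · have h1 := three_lt_flatten h
    have h2 : R.depth x ≠ 0 := (mul_pos R.δ_pos (by linarith)).ne'
    have h3 : R.d x ≠ 0 := by
      rw [R.d_eq]
      exact (mul_pos R.δ_pos (by linarith)).ne'
    simp [h2, h3]

end BoundaryRetraction

end Retraction

/-! ### Increment estimates through the tube of the binding -/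

section Tube

variable {E : Type*} [NormedAddCommGroup E] [NormedSpace ℝ E]
  {H : Type*} [TopologicalSpace H] {I : ModelWithCorners ℝ E H} {V : Type*} [TopologicalSpace V]
  [ChartedSpace H V]
  {E' : Type*} [NormedAddCommGroup E'] [NormedSpace ℝ E']
  {H' : Type*} [TopologicalSpace H'] {J : ModelWithCorners ℝ E' H'} {B : Type*}
  [TopologicalSpace B] [ChartedSpace H' B]
  {E'' : Type*} [NormedAddCommGroup E''] [NormedSpace ℝ E''] [FiniteDimensional ℝ E'']
  {H'' : Type*} [TopologicalSpace H''] {L : ModelWithCorners ℝ E'' H''} {W : Type*}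
  [TopologicalSpace W] [ChartedSpace H'' W] [IsManifold L ∞ W]

/-- As an immersion, `f` controls the increments of `β` by those of `f (β, γ)`. So `i ∘ β` may be
replaced by `A` in the estimate, whatever `γ` is. -/
theorem incrBigO_tube {i : W → V} {f : W × ℂ → B} {β : V → W} {γ : V → ℂ} {A : V → B}
    {D : V → ℝ} {x : V} (hi : ContMDiffAt L I 1 i (β x))
    (hf : ContMDiffWithinAt (L.prod 𝓘(ℝ, ℂ)) J 1 f (univ ×ˢ Metric.closedBall 0 1) (β x, γ x))
    (hinj : Function.Injective (mfderivWithin (L.prod 𝓘(ℝ, ℂ)) J f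
      (univ ×ˢ Metric.closedBall 0 1) (β x, γ x)))
    (hβ : ContinuousAt β x) (hγ : ContinuousAt γ x) (hγ1 : ∀ y, γ y ∈ Metric.closedBall (0 : ℂ) 1)
    (hA : ∀ᶠ y in 𝓝 x, A y = f (β y, γ y))
    (h : IncrBigO (𝓝 x) (extChartAt I x) fun y => (extChartAt I (i (β x)) (i (β y)), D y)) :
    IncrBigO (𝓝 x) (extChartAt I x) fun y => (extChartAt J (A x) (A y), D y) := by
  have : IsManifold L 1 W := .of_le (n := ∞) (by simp)
  have h2 : IncrBigO (𝓝 x) (fun y => extChartAt I (i (β x)) (i (β y)))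
      (fun y => extChartAt L (β x) (β y)) := by
    have h := incrBigO_extChartAt_of_contMDiffWithinAt (S := univ)
      (mem_extChartAt_source (I := L) (β x))
      (by rw [preimage_univ, univ_inter]; exact L.convex_range)
      (contMDiffAt_iff_target.1 hi).2.contMDiffWithinAt
    rw [nhdsWithin_univ] at h
    exact h.comp_tendsto hβ
  have h3 : IncrBigO (𝓝 x) (fun y => (extChartAt L (β x) (β y), γ y))
      (fun y => extChartAt J (A x) (A y)) := by
    have hmem : (β x, γ x) ∈ (univ ×ˢ Metric.closedBall 0 1 : Set (W × ℂ)) := ⟨trivial, hγ1 x⟩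
    have h := incrBigO_of_mfderivWithin_injective hmem
      (by rw [extChartAt_prod_space_symm_preimage]
          exact L.convex_range.prod (convex_closedBall _ _))
      (by
        rw [extChartAt_prod_space_symm_preimage, extChartAt_prod_space]
        refine UniqueDiffWithinAt.prod (L.uniqueDiffOn _ (mem_range_self _)) ?_
        refine (uniqueDiffOn_convex (convex_closedBall _ _) ?_) _ (hγ1 x)
        rw [interior_closedBall _ one_ne_zero]
        exact ⟨0, by simp⟩) hf hinj
    rw [extChartAt_prod_space] at h
    have h' := h.comp_tendsto (k := fun y => (β y, γ y)) (m := 𝓝 x)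
      (tendsto_nhdsWithin_iff.2 ⟨hβ.prodMk hγ, Eventually.of_forall fun y => ⟨trivial, hγ1 y⟩⟩)
    refine h'.congr' EventuallyEq.rfl ?_
    filter_upwards [hA] with y hy
    simp only [Function.comp, hA.self_of_nhds, hy]
  have h4 : IncrBigO (𝓝 x) (fun y => extChartAt L (β x) (β y))
      fun y => (extChartAt J (A x) (A y), D y) :=
    (IncrBigO.fst (a := fun y => (extChartAt L (β x) (β y), γ y)) _).trans
      (h3.trans (IncrBigO.fst (a := fun y => (extChartAt J (A x) (A y), D y)) _))
  exact h.trans ((h2.trans h4).prodMk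
    (IncrBigO.snd (a := fun y => (extChartAt J (A x) (A y), D y)) _))

end Tube

/-! ### Turning the page around the binding -/

section Spin

variable {E : Type*} [NormedAddCommGroup E] [NormedSpace ℝ E]
  {H : Type*} [TopologicalSpace H] {I : ModelWithCorners ℝ E H} {V : Type*} [TopologicalSpace V]
  [ChartedSpace H V]
  {E' : Type*} [NormedAddCommGroup E'] [NormedSpace ℝ E']
  {H' : Type*} [TopologicalSpace H'] {J : ModelWithCorners ℝ E' H'} {B : Type*}
  [TopologicalSpace B] [ChartedSpace H' B] {φ : Monodromy I V}
  (ob : OpenBookDecomposition I φ J B) {N : Set V} (R : BoundaryRetraction I N)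

/-- A map from the page to `B` that rotates the page by `τ` around the binding while keeping the
boundary fixed: the part of the page that is squashed to the boundary is spread over a radius of
the tube. -/
noncomputable def spin (τ : ℝ) (x : V) : B :=
  open Classical in
  if h : R.level x < 1 then
    ob.tube (⟨R.K (x, 0), R.mem_boundary x (R.d_lt (by linarith))⟩, discPath τ (R.level x))
  else ob.page (R.K (x, R.level x), τ)

theorem spin_of_lt_one (τ : ℝ) {x : V} (h : R.level x < 1) :
    spin ob R τ x = ob.tube (⟨R.K (x, 0), R.mem_boundary x (R.d_lt (by linarith))⟩,
      discPath τ (R.level x)) := dif_pos h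

/-- For levels in `[1/2, 1)` the disc path has reached `exp (2πiτ)` and the squashed point lies on
`∂V`, so the gluing identifies the two formulas. This overlap makes the definition smooth across
level `1`. -/
theorem spin_of_half_le (τ : ℝ) {x : V} (h : 1 / 2 ≤ R.level x) :
    spin ob R τ x = ob.page (R.K (x, R.level x), τ) := by
  by_cases h1 : R.level x < 1
  · rw [spin_of_lt_one ob R τ h1, discPath_of_half_le τ h, ← ob.glue, R.of_le_one x _ h1.le]
  · exact dif_neg h1

theorem spin_of_mem_boundary (τ : ℝ) {x : V} (hx : x ∈ I.boundary V) :
    spin ob R τ x = spin ob R 0 x := by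
  have h : R.level x = 0 := (R.level_eq_zero_iff x).2 hx
  rw [spin_of_lt_one ob R τ (by rw [h]; exact one_pos),
    spin_of_lt_one ob R 0 (by rw [h]; exact one_pos)]
  simp only [h, discPath_zero]

theorem page_intCast (k : ℤ) (x : V) : ob.page (x, k) = ob.page (φ.zpow k x, 0) :=
  (ob.page_eq_iff _ _ _ _).2 ⟨k, by simp, rfl⟩

theorem page_injective (τ : ℝ) {x y : V} (h : ob.page (x, τ) = ob.page (y, τ)) : x = y := by
  obtain ⟨m, hm, rfl⟩ := (ob.page_eq_iff _ _ _ _).1 h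
  have : m = 0 := by exact_mod_cast (left_eq_add.1 hm)
  subst this
  rfl

theorem zpow_apply_eq_self {x : V} (k : ℤ) (hx : φ x = x) : φ.zpow k x = x :=
  Equiv.Perm.zpow_apply_eq_self_of_apply_eq_self hx k

/-- Below level `5` everything in sight is fixed by `φ`, and the disc path is constant. From level
`5` on the squash is the identity, the claim is the mapping torus relation, and depth is constant.
The power of `φ` preserves this region, because by injectivity it cannot send a point onto a fixed
point other than itself. -/
theorem spin_intCast (hN : ∀ x ∈ N, φ x = x) (k : ℤ) (x : V) :
    spin ob R k x = spin ob R 0 (φ.zpow k x) ∧ R.depth x = R.depth (φ.zpow k x) := by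
  have hfix : ∀ y, R.level y < 5 → φ.zpow k y = y := fun y hy => by
    refine zpow_apply_eq_self k (hN y ?_)
    have := R.mem y (R.d_lt hy) 3 (by norm_num)
    rwa [R.of_two_le y 3 (by norm_num)] at this
  rcases lt_or_ge (R.level x) 5 with h | h
  · rw [hfix x h]
    refine ⟨?_, rfl⟩
    rcases lt_or_ge (R.level x) 1 with h1 | h1
    · have h0 : discPath 0 (R.level x) = 1 := by simpa using discPath_intCast 0 (R.level x)
      rw [spin_of_lt_one ob R k h1, spin_of_lt_one ob R 0 h1, discPath_intCast, h0]
    · rw [spin_of_half_le ob R k (by linarith), spin_of_half_le ob R 0 (by linarith),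
        page_intCast]
      congr 2
      rcases lt_or_ge (R.level x) 3 with h3 | h3
      · exact zpow_apply_eq_self k (hN _ (R.mem x (R.d_lt h) _ ⟨by linarith, h3.le⟩))
      · rw [R.of_two_le x _ (by linarith), hfix x h]
  · have h' : 5 ≤ R.level (φ.zpow k x) := by
      by_contra! h'
      have h1 : φ.zpow k x = x := by
        have h2 := hfix _ h'
        exact (φ.toPerm ^ k).injective h2
      rw [h1] at h'
      linarith
    refine ⟨?_, ?_⟩
    · rw [spin_of_half_le ob R k (by linarith), spin_of_half_le ob R 0 (by linarith),
        page_intCast, R.of_two_le x _ (by linarith), R.of_two_le _ _ (by linarith)]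
    · rw [BoundaryRetraction.depth, BoundaryRetraction.depth, flatten_of_four_le (by linarith),
        flatten_of_four_le (by linarith)]

/-- Up to level `3` the depth determines `d`, hence the level, and the squashed point together with
these determines `x`. Above level `3` the page alone does. The position on the disc path is not
needed, so the path may be constant or pass through the centre. -/
theorem spin_depth_injective (τ : ℝ) {x y : V} (h : spin ob R τ x = spin ob R τ y)
    (hd : R.depth x = R.depth y) : x = y := by
  rcases le_or_gt (R.level x) 3 with hx | hx
  · have hy := R.level_le_three_of_depth hx hd
    rw [R.depth_of_level_le_three hx, R.depth_of_level_le_three hy] at hd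
    have hl : R.level x = R.level y := by rw [BoundaryRetraction.level, hd]; rfl
    have hdx := R.d_lt (show R.level x < 5 by linarith)
    have hdy := R.d_lt (show R.level y < 5 by linarith)
    rcases lt_or_ge (R.level x) 1 with h1 | h1
    · have h1' : R.level y < 1 := hl ▸ h1
      rw [spin_of_lt_one ob R τ h1, spin_of_lt_one ob R τ h1'] at h
      have h2 := ob.tube_injOn ⟨trivial, discPath_mem _ _⟩ ⟨trivial, discPath_mem _ _⟩ h
      have h3 : R.K (x, 0) = R.K (y, 0) := congrArg Subtype.val (Prod.mk.inj h2).1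
      have h4 := R.injOn (show (x, (0 : ℝ)) ∈ _ from ⟨by norm_num, hdx⟩)
        (show (y, (0 : ℝ)) ∈ _ from ⟨by norm_num, hdy⟩) (Prod.ext h3 (Prod.ext hd rfl))
      exact (Prod.mk.inj h4).1
    · rw [spin_of_half_le ob R τ (by linarith), spin_of_half_le ob R τ (by linarith)] at h
      have h3 := page_injective ob τ h
      have h4 := R.injOn (show (x, R.level x) ∈ _ from ⟨⟨by linarith, hx⟩, hdx⟩)
        (show (y, R.level y) ∈ _ from ⟨⟨by linarith, hy⟩, hdy⟩) (Prod.ext h3 (Prod.ext hd hl))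
      exact (Prod.mk.inj h4).1
  · have hy : 3 < R.level y := by
      by_contra! hy
      linarith [R.level_le_three_of_depth hy hd.symm]
    rw [spin_of_half_le ob R τ (by linarith), spin_of_half_le ob R τ (by linarith),
      R.of_two_le x _ (by linarith), R.of_two_le y _ (by linarith)] at h
    exact page_injective ob τ h

variable [FiniteDimensional ℝ E] [IsManifold I ∞ V]

/-- The tube takes points of `∂V` as arguments, whereas the squash is smooth as a map to `V`.
Lifting through the inclusion of `∂V`, an immersion, gives a smooth map to `∂V`; its value at levels
`≥ 1` is a dummy. -/
theorem exists_boundary_lift {x₀ : V} (h₀ : R.level x₀ < 1) :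
    letI := ob.chartedSpace
    ∃ β : V → I.boundary V, ContMDiffAt I (𝓡 (finrank ℝ E - 1)) ∞ β x₀ ∧
      ∀ᶠ x in 𝓝 x₀, R.K (x, 0) = β x ∧
        ∀ τ, spin ob R τ x = ob.tube (β x, discPath τ (R.level x)) := by
  let _ := ob.chartedSpace
  have := ob.isManifold
  classical
  have hev : ∀ᶠ x in 𝓝 x₀, R.level x < 1 :=
    R.contMDiff_level.continuous.continuousAt.eventually (gt_mem_nhds h₀)
  set β : V → I.boundary V := fun x => if h : R.level x < 1 then
    ⟨R.K (x, 0), R.mem_boundary x (R.d_lt (by linarith))⟩ else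
    ⟨R.K (x₀, 0), R.mem_boundary x₀ (R.d_lt (by linarith))⟩ with hβ
  have hβv : ∀ᶠ x in 𝓝 x₀, R.K (x, 0) = β x := by
    filter_upwards [hev] with x hx
    simp only [hβ, dif_pos hx]
  have hKs : ContMDiff I I ∞ fun x => R.K (x, 0) :=
    R.contMDiff.comp (contMDiff_id.prodMk contMDiff_const)
  have hβs : ContMDiffAt I I ∞ (Subtype.val ∘ β) x₀ :=
    (hKs x₀).congr_of_eventuallyEq (hβv.mono fun x hx => hx.symm)
  refine ⟨β, ?_, ?_⟩
  · exact ContMDiffAt.of_comp_immersion ob.isDiffEmbedding.contMDiff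
      (ob.isDiffEmbedding.mfderiv_injective _)
      (Topology.IsInducing.subtypeVal.continuousAt_iff.2 hβs.continuousAt) hβs
  · filter_upwards [hβv, hev] with x hx hx1
    refine ⟨hx, fun τ => ?_⟩
    rw [spin_of_lt_one ob R τ hx1]
    congr 2
    exact Subtype.ext hx

theorem contMDiff_spin :
    ContMDiff (𝓘(ℝ, ℝ).prod I) J ∞ fun q : ℝ × V => spin ob R q.1 q.2 := by
  let _ := ob.chartedSpace
  have := ob.isManifold
  rintro ⟨τ, x⟩
  rcases lt_or_ge (R.level x) 1 with h | h
  · obtain ⟨β, hβ, hev⟩ := exists_boundary_lift ob R h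
    have h1 : ContMDiffAt (𝓘(ℝ, ℝ).prod I) ((𝓡 (finrank ℝ E - 1)).prod 𝓘(ℝ, ℂ)) ∞
        (fun q : ℝ × V => (β q.2, discPath q.1 (R.level q.2))) (τ, x) := by
      refine ContMDiffAt.prodMk (hβ.comp (τ, x) contMDiffAt_snd) ?_
      exact (contDiff_discPath.contMDiff.comp
        (contMDiff_fst.prodMk_space (R.contMDiff_level.comp contMDiff_snd))) (τ, x)
    have h2 := (ob.tube_smooth (β x, discPath τ (R.level x)) ⟨trivial, discPath_mem _ _⟩)
    have h3 : ContMDiffAt (𝓘(ℝ, ℝ).prod I) J ∞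
        (fun q : ℝ × V => ob.tube (β q.2, discPath q.1 (R.level q.2))) (τ, x) := by
      have hm : MapsTo (fun q : ℝ × V => (β q.2, discPath q.1 (R.level q.2))) univ
          (univ ×ˢ Metric.closedBall 0 1) := fun q _ => ⟨trivial, discPath_mem _ _⟩
      rw [← contMDiffWithinAt_univ] at h1 ⊢
      exact h2.comp (τ, x) h1 hm
    refine h3.congr_of_eventuallyEq ?_
    filter_upwards [(continuous_snd.tendsto (τ, x)).eventually hev] with q hq using hq.2 q.1
  · have h1 : ContMDiff (𝓘(ℝ, ℝ).prod I) J ∞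
        (fun q : ℝ × V => ob.page (R.K (q.2, R.level q.2), q.1)) :=
      ob.page_smooth.comp ((R.contMDiff.comp (contMDiff_snd.prodMk
        (R.contMDiff_level.comp contMDiff_snd))).prodMk contMDiff_fst)
    refine (h1 (τ, x)).congr_of_eventuallyEq ?_
    have h2 : ∀ᶠ q : ℝ × V in 𝓝 (τ, x), 1 / 2 < R.level q.2 :=
      (R.contMDiff_level.continuous.comp continuous_snd).continuousAt.eventually
        (lt_mem_nhds (by simp only [Function.comp]; linarith))
    filter_upwards [h2] with q hq using spin_of_half_le ob R q.1 hq.le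

/-- The tube recovers the squashed point on `∂V`, depth agrees with `d`, and the squash estimate at
`w = 0` recovers `x` from these two. -/
theorem spin_depth_incrBigO_of_lt_one (τ : ℝ) {x : V} (h : R.level x < 1) :
    IncrBigO (𝓝 x) (extChartAt I x)
      (fun y => (extChartAt J (spin ob R τ x) (spin ob R τ y), R.depth y)) := by
  let _ := ob.chartedSpace
  have := ob.isManifold
  obtain ⟨β, hβ, hev⟩ := exists_boundary_lift ob R h
  have hKx : R.K (x, 0) = β x := hev.self_of_nhds.1
  refine incrBigO_tube (W := I.boundary V) (i := Subtype.val) (f := ob.tube) (β := β)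
    (γ := fun y => discPath τ (R.level y))
    ((ob.isDiffEmbedding.contMDiff _).of_le (by simp))
    ((ob.tube_smooth _ ⟨trivial, discPath_mem _ _⟩).of_le (by simp))
    (ob.tube_mfderiv _ ⟨trivial, discPath_mem _ _⟩).injective hβ.continuousAt ?_
    (fun y => discPath_mem _ _) (hev.mono fun y hy => hy.2 τ) ?_
  · exact (contDiff_discPath.continuous.comp
      (continuous_const.prodMk R.contMDiff_level.continuous)).continuousAt
  have h1 := (R.incrBigO x (R.d_lt (by linarith)) 0 (by norm_num)).comp_tendsto
    (k := fun y : V => (y, (0 : ℝ))) (m := 𝓝 x)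
    ((continuous_id.prodMk continuous_const).tendsto x)
  refine IncrBigO.trans (IncrBigO.fst (a := fun y => (extChartAt I x y, (0 : ℝ))) _)
    (IncrBigO.trans h1 ?_)
  have h2 : IncrBigO (𝓝 x) (fun y => (extChartAt I (β x : V) (β y), R.depth y, (0 : ℝ)))
      (fun y => (extChartAt I (β x : V) (β y), R.depth y)) :=
    (IncrBigO.fst (a := fun y => (extChartAt I (β x : V) (β y), R.depth y)) _).prodMk
      ((IncrBigO.snd (a := fun y => (extChartAt I (β x : V) (β y), R.depth y)) _).prodMk
        (IncrBigO.const _ _ _))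
  refine h2.congr' ?_ EventuallyEq.rfl
  filter_upwards [hev, R.contMDiff_level.continuous.continuousAt.eventually
      (gt_mem_nhds (show R.level x < 3 by linarith))] with y hy hy3
  simp only [Function.comp, hKx, hy.1, R.depth_of_level_le_three hy3.le]

/-- The page recovers the squashed point. Below level `3` the depth also controls `d` and the level,
so the squash estimate along the graph of the level applies. From level `3` on the squash is the
identity near `x`, and the flattened depth is not needed. -/
theorem spin_depth_incrBigO_of_one_le (τ : ℝ) {x : V} (h : 1 ≤ R.level x) :
    IncrBigO (𝓝 x) (extChartAt I x)
      (fun y => (extChartAt J (spin ob R τ x) (spin ob R τ y), R.depth y)) := by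
  have hc := R.contMDiff_level.continuous
  set κ : V → V := fun y => R.K (y, R.level y) with hκ
  have hκc : Continuous κ := R.contMDiff.continuous.comp (continuous_id.prodMk hc)
  have hsp : ∀ᶠ y in 𝓝 x, spin ob R τ y = ob.page (κ y, τ) := by
    filter_upwards [hc.continuousAt.eventually (lt_mem_nhds (show 1 / 2 < R.level x by linarith))]
      with y hy using spin_of_half_le ob R τ hy.le
  have hpage : IncrBigO (𝓝 x) (fun y => extChartAt I (κ x) (κ y))
      (fun y => (extChartAt J (spin ob R τ x) (spin ob R τ y), R.depth y)) := by
    have h1 := incrBigO_of_mfderiv_injective (((ob.page_smooth) (κ x, τ)).of_le (by simp))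
      (ob.page_mfderiv (κ x, τ)).injective
    rw [extChartAt_prod_space] at h1
    have h2 := h1.comp_tendsto (k := fun y => (κ y, τ)) (m := 𝓝 x)
      ((hκc.prodMk continuous_const).tendsto x)
    have h3 : IncrBigO (𝓝 x) (fun y => (extChartAt I (κ x) (κ y), τ))
        (fun y => extChartAt J (spin ob R τ x) (spin ob R τ y)) := by
      refine h2.congr' EventuallyEq.rfl ?_
      filter_upwards [hsp] with y hy
      simp only [Function.comp, hsp.self_of_nhds, hy]
    exact (IncrBigO.fst (a := fun y => (extChartAt I (κ x) (κ y), τ)) _).trans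
      (h3.trans (IncrBigO.fst (a := fun y =>
        (extChartAt J (spin ob R τ x) (spin ob R τ y), R.depth y)) _))
  rcases lt_or_ge (R.level x) 3 with h3 | h3
  · have hdepth : R.d =ᶠ[𝓝 x] R.depth := by
      filter_upwards [hc.continuousAt.eventually (gt_mem_nhds h3)] with y hy
      exact (R.depth_of_level_le_three hy.le).symm
    have hd : IncrBigO (𝓝 x) R.d
        (fun y => (extChartAt J (spin ob R τ x) (spin ob R τ y), R.depth y)) :=
      (IncrBigO.snd (a := fun y =>
        (extChartAt J (spin ob R τ x) (spin ob R τ y), R.depth y)) _).congr' hdepth.symm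
          EventuallyEq.rfl
    have hl : IncrBigO (𝓝 x) R.level R.d := by
      refine IsBigO.of_bound (R.δ⁻¹) (Eventually.of_forall fun q => le_of_eq ?_)
      simp only [BoundaryRetraction.level]
      rw [← sub_div, norm_div, Real.norm_of_nonneg R.δ_pos.le]
      ring
    have h1 := (R.incrBigO x (R.d_lt (by linarith)) (R.level x) ⟨by linarith, h3.le⟩).comp_tendsto
      (k := fun y : V => (y, R.level y)) (m := 𝓝 x) ((continuous_id.prodMk hc).tendsto x)
    exact (IncrBigO.fst (a := fun y => (extChartAt I x y, R.level y)) _).trans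
      (h1.trans (hpage.prodMk (hd.prodMk (hl.trans hd))))
  · have hκx : κ x = x := R.of_two_le x _ (by linarith)
    rw [hκx] at hpage
    refine hpage.congr' ?_ EventuallyEq.rfl
    filter_upwards [hc.continuousAt.eventually (lt_mem_nhds (show 2 < R.level x by linarith))]
      with y hy
    simp only [hκ, R.of_two_le y _ hy.le]

theorem spin_depth_incrBigO (τ : ℝ) (x : V) :
    IncrBigO (𝓝 x) (extChartAt I x)
      (fun y => (extChartAt J (spin ob R τ x) (spin ob R τ y), R.depth y)) := by
  rcases lt_or_ge (R.level x) 1 with h | h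
  exacts [spin_depth_incrBigO_of_lt_one ob R τ h, spin_depth_incrBigO_of_one_le ob R τ h]

end Spin

/-! ### Transversality to the boundary -/

section ProperEmbedding

variable {E : Type*} [NormedAddCommGroup E] [NormedSpace ℝ E] [FiniteDimensional ℝ E]
  {H : Type*} [TopologicalSpace H] {I : ModelWithCorners ℝ E H} [IsHalfSpaceModel I]
  {V : Type*} [TopologicalSpace V] [ChartedSpace H V] [IsManifold I ∞ V]
  {E' : Type*} [NormedAddCommGroup E'] [NormedSpace ℝ E'] [FiniteDimensional ℝ E']
  {H' : Type*} [TopologicalSpace H'] {J : ModelWithCorners ℝ E' H'}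
  {P : Type*} [TopologicalSpace P] [ChartedSpace H' P] [IsManifold J ∞ P]

/-- A smooth map that takes the boundary to the boundary, and pulls a boundary defining function
back to a function that is at least of the order of one, is transverse to the boundary. -/
theorem exists_mfderiv_ne_zero_of_isBigO {f : V → P} {x : V} {d : V → ℝ} {d' : P → ℝ}
    (hd : IsBoundaryDefining I d) (hd' : IsBoundaryDefining J d') (hf : ContMDiffAt I J ∞ f x)
    (hx : x ∈ I.boundary V) (hfx : f x ∈ J.boundary P) (h : d =O[𝓝 x] (d' ∘ f))
    {ℓ' : E' →L[ℝ] ℝ} (hℓ' : range J = {y | 0 ≤ ℓ' y}) :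
    ∃ v : TangentSpace I x, ℓ' (mfderiv I J f x v) ≠ 0 := by
  have : IsManifold I 1 V := .of_le (n := ∞) (by simp)
  have : IsManifold J 1 P := .of_le (n := ∞) (by simp)
  obtain ⟨ℓ, hℓ⟩ := IsHalfSpaceModel.exists_range_eq (I := I)
  have h0 := ne_zero_of_mem_boundary hℓ hx
  have h0' := ne_zero_of_mem_boundary hℓ' hfx
  obtain ⟨e, he⟩ := surjective_of_ne_zero h0 1
  have hxs := mem_extChartAt_source (I := I) x
  set z := extChartAt I x x with hz
  have hz0 : ℓ z = 0 := (mem_boundary_iff hℓ h0 hxs).1 hx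
  have hO : (fun y => ℓ (extChartAt I x y)) =O[𝓝 x] fun y => ℓ' (extChartAt J (f x) (f y)) :=
    ((hd.height_isBigO ℓ hℓ x hx x hxs).trans h).trans
      ((hd'.isBigO_height hℓ' hfx (mem_extChartAt_source _)).comp_tendsto hf.continuousAt)
  obtain ⟨C, hC, hB⟩ := hO.exists_pos
  set D : E →L[ℝ] E' := mfderiv I J f x with hD
  have hder : HasFDerivWithinAt (writtenInExtChartAt I J x f) D (range I) z :=
    (hf.mdifferentiableAt (by simp)).hasMFDerivAt.2
  have hcone : ∀ᶠ t : ℝ in 𝓝[≥] 0, z + t • e ∈ range I := by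
    filter_upwards [eventually_nonneg_add_smul hz0 (by rw [he]; exact zero_le_one)] with t ht
    rw [hℓ]
    exact ht
  have hlim := tendsto_add_smul_nhdsWithin hcone
  have hsx : Tendsto (fun t : ℝ => (extChartAt I x).symm (z + t • e)) (𝓝[≥] 0) (𝓝 x) :=
    Tendsto.comp (map_extChartAt_symm_nhdsWithin_range (I := I) x).le hlim
  -- The witness is the inward vector of height `1`: along its ray the height of the image is at
  -- least `t / C`, so its derivative is positive.
  refine ⟨e, ?_⟩
  have key := HasFDerivWithinAt.apply_nonneg (g := fun y => ℓ' (writtenInExtChartAt I J x f y))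
    (g' := ℓ'.comp D) (v := e) (a := 1 / C) (ℓ'.hasFDerivAt.comp_hasFDerivWithinAt _ hder) hcone
    (by
      simp only [writtenInExtChartAt, Function.comp, hz, (extChartAt I x).left_inv hxs]
      exact (mem_boundary_iff hℓ' h0' (mem_extChartAt_source _)).1 hfx) (by
      filter_upwards [hsx.eventually hB.bound, hlim (extChartAt_target_mem_nhdsWithin x),
        (hf.continuousAt.tendsto.comp hsx) (extChartAt_source_mem_nhds (I := J) (f x))]
        with t ht ht1 ht2
      have hs : f ((extChartAt I x).symm (z + t • e)) ∈ (extChartAt J (f x)).source := ht2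
      rw [(extChartAt I x).right_inv ht1, map_add, map_smul, hz0, he, zero_add, smul_eq_mul,
        mul_one, Real.norm_of_nonneg (apply_extChartAt_nonneg hℓ' hs)] at ht
      rw [← mul_div_assoc, mul_one, div_le_iff₀' hC]
      exact (le_abs_self t).trans ht)
  have hpos : 0 < 1 / C := by positivity
  exact (hpos.trans_le key).ne'

end ProperEmbedding

/-! ### The spun pages as proper embeddings, and the theorem -/

section SpunPage

variable {E : Type*} [NormedAddCommGroup E] [NormedSpace ℝ E] [FiniteDimensional ℝ E]
  {H : Type*} [TopologicalSpace H] {I : ModelWithCorners ℝ E H}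
  {V : Type*} [TopologicalSpace V] [ChartedSpace H V] [IsManifold I ∞ V]
  {E' : Type*} [NormedAddCommGroup E'] [NormedSpace ℝ E']
  {H' : Type*} [TopologicalSpace H'] {J : ModelWithCorners ℝ E' H'}
  {P : Type*} [TopologicalSpace P] [ChartedSpace H' P]
  {E'' : Type*} [NormedAddCommGroup E''] [NormedSpace ℝ E'']
  {H'' : Type*} [TopologicalSpace H''] {L : ModelWithCorners ℝ E'' H''} {B : Type*}
  [TopologicalSpace B] [ChartedSpace H'' B] {φ : Monodromy I V}
  (ob : OpenBookDecomposition I φ L B) {N : Set V} (R : BoundaryRetraction I N)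
  {ε : ℝ} {Ψ : B × ℝ → P} {d' : P → ℝ}

theorem contMDiff_collar_spin (hR : 4 * R.δ ≤ ε)
    (hΨ : ContMDiffOn (L.prod 𝓘(ℝ, ℝ)) J ∞ Ψ (univ ×ˢ Icc 0 ε)) :
    ContMDiff (𝓘(ℝ, ℝ).prod I) J ∞
      fun q : ℝ × V => Ψ (spin ob R q.1 q.2, R.depth q.2) :=
  hΨ.comp_contMDiff ((contMDiff_spin ob R).prodMk (R.contMDiff_depth.comp contMDiff_snd))
    fun q => ⟨trivial, Icc_subset_Icc_right hR (R.depth_mem q.2)⟩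

variable [IsHalfSpaceModel I] [CompactSpace V] [FiniteDimensional ℝ E'] [IsManifold J ∞ P]
  [T2Space P]

/-- An injective continuous map from a compact space to a Hausdorff one is an embedding. The
estimates for the collar and for `(spin, depth)` compose to give the immersion. Depth vanishes
exactly on `∂V` and equals `d` near it, which gives the boundary condition and, by the linear growth
of the collar, transversality. -/
theorem isProperEmbedding_collar_spin (hR : 4 * R.δ ≤ ε) (hd' : IsBoundaryDefining J d')
    (hΨ : ContMDiffOn (L.prod 𝓘(ℝ, ℝ)) J ∞ Ψ (univ ×ˢ Icc 0 ε))
    (hinj : InjOn Ψ (univ ×ˢ Icc 0 ε)) (hΨ0 : ∀ b, Ψ (b, 0) ∈ J.boundary P)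
    (hΨb : ∀ b, ∀ s ∈ Ioc 0 ε, Ψ (b, s) ∉ J.boundary P)
    (hΨd : ∀ b, (fun q : B × ℝ => q.2) =O[𝓝 b ×ˢ 𝓝[≥] 0] (d' ∘ Ψ))
    (hΨi : ∀ q ∈ univ ×ˢ Icc 0 ε, IncrBigO (𝓝[univ ×ˢ Icc 0 ε] q)
      (fun y : B × ℝ => (extChartAt L q.1 y.1, y.2)) (extChartAt J (Ψ q) ∘ Ψ)) (τ : ℝ) :
    IsProperEmbedding I J fun x => Ψ (spin ob R τ x, R.depth x) := by
  have hmem : ∀ x, R.depth x ∈ Icc 0 ε := fun x => Icc_subset_Icc_right hR (R.depth_mem x)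
  have hs : ContMDiff I L ∞ (spin ob R τ) :=
    (contMDiff_spin ob R).comp (contMDiff_const.prodMk contMDiff_id)
  have hF : ContMDiff I J ∞ fun x => Ψ (spin ob R τ x, R.depth x) :=
    (contMDiff_collar_spin ob R hR hΨ).comp (contMDiff_const.prodMk contMDiff_id)
  have hb : ∀ x, Ψ (spin ob R τ x, R.depth x) ∈ J.boundary P ↔ x ∈ I.boundary V := by
    intro x
    rw [← R.depth_eq_zero_iff]
    refine ⟨fun h => ?_, fun h => by rw [h]; exact hΨ0 _⟩
    by_contra hne
    exact hΨb _ _ ⟨lt_of_le_of_ne (hmem x).1 (Ne.symm hne), (hmem x).2⟩ h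
  have hq : ∀ x, Tendsto (fun y => (spin ob R τ y, R.depth y)) (𝓝 x)
      (𝓝[univ ×ˢ Icc 0 ε] (spin ob R τ x, R.depth x)) := fun x =>
    tendsto_nhdsWithin_iff.2
      ⟨(hs.continuous.prodMk R.contMDiff_depth.continuous).tendsto x,
        Eventually.of_forall fun y => ⟨trivial, hmem y⟩⟩
  refine ⟨⟨hF, ?_, fun x => ?_⟩, ?_, fun ℓ' hℓ' x hx => ?_⟩
  · refine (hF.continuous.isClosedEmbedding fun x y hxy => ?_).isEmbedding
    have h := hinj ⟨trivial, hmem x⟩ ⟨trivial, hmem y⟩ hxy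
    exact spin_depth_injective ob R τ (Prod.mk.inj h).1 (Prod.mk.inj h).2
  · refine mfderiv_injective_of_incrBigO ((hF x).mdifferentiableAt (by simp)) ?_
    exact (spin_depth_incrBigO ob R τ x).trans
      ((hΨi (spin ob R τ x, R.depth x) ⟨trivial, hmem x⟩).comp_tendsto (hq x))
  · ext x
    exact hb x
  · refine exists_mfderiv_ne_zero_of_isBigO R.isBoundaryDefining hd' (hF x) hx ((hb x).2 hx) ?_ hℓ'
    have h0 : R.level x = 0 := (R.level_eq_zero_iff x).2 hx
    have ht : Tendsto (fun y => (spin ob R τ y, R.depth y)) (𝓝 x)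
        (𝓝 (spin ob R τ x) ×ˢ 𝓝[≥] 0) := by
      refine (hs.continuous.tendsto x).prodMk (tendsto_nhdsWithin_iff.2
        ⟨?_, Eventually.of_forall fun y => (hmem y).1⟩)
      have := R.contMDiff_depth.continuous.tendsto x
      rwa [(R.depth_eq_zero_iff x).2 hx] at this
    refine ((hΨd (spin ob R τ x)).comp_tendsto ht).congr' ?_ EventuallyEq.rfl
    filter_upwards [R.contMDiff_level.continuous.continuousAt.eventually
      (gt_mem_nhds (show R.level x < 3 by rw [h0]; norm_num))] with y hy
    exact R.depth_of_level_le_three hy.le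

end SpunPage

end SpunEmbedding

open SpunEmbedding in
theorem theorem1p1 (n : ℕ)
    -- the closed orientable manifold `M`
    {EM : Type*} [NormedAddCommGroup EM] [NormedSpace ℝ EM] [FiniteDimensional ℝ EM]
    {HM : Type*} [TopologicalSpace HM] (IM : ModelWithCorners ℝ EM HM) [IM.Boundaryless]
    {M : Type*} [TopologicalSpace M] [ChartedSpace HM M] [IsManifold IM ∞ M]
    [T2Space M] [CompactSpace M]
    (hM : finrank ℝ EM = n) (hMor : IsOrientable IM M)
    -- the page `P` and the monodromy `ρ` of its open book
    {EP : Type*} [NormedAddCommGroup EP] [NormedSpace ℝ EP] [FiniteDimensional ℝ EP]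
    {HP : Type*} [TopologicalSpace HP] (IP : ModelWithCorners ℝ EP HP) [IsHalfSpaceModel IP]
    {P : Type*} [TopologicalSpace P] [ChartedSpace HP P] [IsManifold IP ∞ P]
    [T2Space P] [CompactSpace P]
    (hP : finrank ℝ EP + 1 = n)
    (ρ : Monodromy IP P) (obM : OpenBookDecomposition IP ρ IM M)
    -- the connected component `B` of the binding, embedded in `P` by `j`
    {EB : Type*} [NormedAddCommGroup EB] [NormedSpace ℝ EB] [FiniteDimensional ℝ EB]
    {HB : Type*} [TopologicalSpace HB] (IB : ModelWithCorners ℝ EB HB) [IB.Boundaryless]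
    {B : Type*} [TopologicalSpace B] [ChartedSpace HB B] [IsManifold IB ∞ B]
    [T2Space B] [CompactSpace B]
    (hB : finrank ℝ EB + 2 = n)
    (j : B → P) (hj : IsDiffEmbedding IB IP j)
    (hjB : ∃ p ∈ IP.boundary P, range j = connectedComponentIn (IP.boundary P) p)
    -- the page `V` and the monodromy `φ` of an open book of `B`
    {EV : Type*} [NormedAddCommGroup EV] [NormedSpace ℝ EV] [FiniteDimensional ℝ EV]
    {HV : Type*} [TopologicalSpace HV] (IV : ModelWithCorners ℝ EV HV) [IsHalfSpaceModel IV]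
    {V : Type*} [TopologicalSpace V] [ChartedSpace HV V] [IsManifold IV ∞ V]
    [T2Space V] [CompactSpace V]
    (hV : finrank ℝ EV + 3 = n)
    (φ : Monodromy IV V) (obB : OpenBookDecomposition IV φ IB B)
    (k : ℤ) :
    SpunEmbeds (φ.zpow k) ρ := by
  have hjb : ∀ b, j b ∈ IP.boundary P := by
    obtain ⟨p, -, hp⟩ := hjB
    intro b
    exact connectedComponentIn_subset _ _ (hp ▸ mem_range_self b)
  obtain ⟨d', hd'⟩ := exists_isBoundaryDefining IP P
  obtain ⟨ε, hε, Ψ, hΨ, hinj, hΨ0, hΨb, hΨd, hΨi⟩ :=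
    exists_collar hd' hj hjb (N := {y | ρ y = y}) ρ.eq_near_boundary
  -- Depth takes values in `[0, 4 * δ]`, so `δ ≤ ε / 4` keeps the page inside the collar.
  obtain ⟨R, hR⟩ := BoundaryRetraction.exists_le (N := {x | φ x = x}) φ.eq_near_boundary
    (show 0 < ε / 4 by positivity)
  have hR4 : 4 * R.δ ≤ ε := by linarith
  have hmem : ∀ x, R.depth x ∈ Icc 0 ε := fun x => Icc_subset_Icc_right hR4 (R.depth_mem x)
  have hproper := isProperEmbedding_collar_spin obB R hR4 hd' hΨ hinj
    (fun b => by rw [hΨ0]; exact hjb b) hΨb hΨd (fun q hq => (hΨi q hq).2)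
  refine ⟨fun x => Ψ (spin obB R 0 x, R.depth x), hproper 0,
    -- The angle `k` at `t = 0` gives `g ∘ φ ^ k`; the angle `0` at `t = 1` gives `g`.
    fun t x => Ψ (spin obB R (k * (1 - t)) x, R.depth x), ?_, fun t _ => hproper _, ?_, ?_, ?_⟩
  · have h1 : ContDiff ℝ ∞ fun t : ℝ => (k : ℝ) * (1 - t) :=
      contDiff_const.mul (contDiff_const.sub contDiff_id)
    exact ((contMDiff_collar_spin obB R hR4 hΨ).comp
      ((h1.contMDiff.comp contMDiff_fst).prodMk contMDiff_snd)).contMDiffOn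
  · funext x
    obtain ⟨h1, h2⟩ := spin_intCast obB R (fun _ hx => hx) k x
    simp only [sub_zero, mul_one, h1, h2]
    rfl
  · funext x
    simp only [sub_self, mul_zero]
    -- The collar was chosen in the fixed point set of `ρ`, so `ρ ∘ g = g`.
    exact ((hΨi (spin obB R 0 x, R.depth x) ⟨trivial, hmem x⟩).1).symm
  · intro t _ x hx
    obtain ⟨h1, h2⟩ := spin_intCast obB R (fun _ hx => hx) k x
    simp only [Function.comp]
    rw [spin_of_mem_boundary obB R _ hx, ← spin_of_mem_boundary obB R k hx, h1, h2]
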